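/- Let $N\ge 1$ and let $V=V^*\in L^1(0,1)$ be an $N\times N$ complex matrix-valued potential. Consider the Dirichlet problem $-\psi''+V\psi=\lambda\psi$ on $[0,1]$, $\psi(0)=\psi(1)=0$, with (real) eigenvalues $\lambda_1<\lambda_2<\dots$ of multiplicities $k_1,k_2,\dots$. For $\lambda\in\mathbb C$ let $\varphi(x,\lambda)$, $\chi(x,\lambda)$ be the $N\times N$ matrix solutions of $-y''+Vy=\lambda y$ with $\varphi(0)=0,\ \varphi'(0)=I$ and $\chi(1)=0,\ \chi'(1)=I$, and let $m(\lambda)=\chi'(0,\lambda)\chi(0,\lambda)^{-1}$ be the Weyl–Titchmarsh function. For $\alpha\ge 1$ put $$\varphi_\alpha(x)=\varphi(x,\lambda_\alpha),\quad S_\alpha(x)=\int_0^x\varphi_\alpha^*\varphi_\alpha\,dt,\quad B_\alpha=-\operatorname*{res}_{\lambda=\lambda_\alpha}m(\lambda),\quad \mathcal E_\alpha=\operatorname{Ker}\varphi_\alpha(1),\quad \mathcal F_\alpha=\mathbb C^N\ominus S_\alpha(1)(\mathcal E_\alpha).$$ Fix $\alpha\ge1$ and let $B=B^*\ge 0$ be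 an $N\times N$ matrix with $\operatorname{rank}B=k_\alpha$ and $(\mathbb C^N\ominus\operatorname{Ker}B)\cap\mathcal F_\alpha=\{0\}$. Put $A=B-B_\alpha$, and for $x\in[0,1]$ $$K(x)=A\,(I+S_\alpha(x)A)^{-1},\qquad \widetilde V(x)=V(x)-2\,[\varphi_\alpha K\varphi_\alpha^*]'(x).$$ Then: 1. $\det(I+S_\alpha(x)A)\ne0$ and $K(x)=K(x)^*$ for all $x\in[0,1]$, and $\varphi_\alpha K\varphi_\alpha^*$ is differentiable on $[0,1]$; 2. $\widetilde V-V$ is absolutely continuous on $[0,1]$ with $(\widetilde V-V)'\in L^1(0,1)$; 3. $\widetilde V=\widetilde V^*\in L^1(0,1)$, and $\widetilde V$ is isospectral to $V$: it has the same Dirichlet eigenvalues with the same multiplicities; 4. writing a tilde for the objects built from $\widetilde V$ in place of $V$, $\widetilde B_\beta=B_\beta$ for all $\beta\ne\alpha$, and $$\widetilde B_\alpha=B,\qquad \widetilde{\mathcal E}_\alpha=\mathbb C^N\ominus\operatorname{Ker}B,\qquad \widetilde{\mathcal F}_\alpha=\mathcal F_\alpha .$$ -/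

import Mathlib

open MeasureTheory Set Filter Topology
open scoped Matrix ComplexOrder

namespace SturmLiouville

noncomputable section

/-- `V = V* ∈ L¹(0,1)`: an `N × N` matrix potential with integrable entries that is Hermitian
almost everywhere on `(0,1)`. Values outside `[0,1]` play no role. -/
structure IsPotential {N : ℕ} (V : ℝ → Matrix (Fin N) (Fin N) ℂ) : Prop where
  hermitian : ∀ᵐ x ∂(volume.restrict (Ioo (0 : ℝ) 1)), (V x).IsHermitian
  integrable : ∀ i j, IntegrableOn (fun x => V x i j) (Ioo (0 : ℝ) 1)

/-- The pair `(u, u')` is a solution of `-u'' + V u = z u` on `[0,1]`: `u` and `u'` are absolutely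
continuous, `u'` is the derivative of `u`, and `(u')' = V u - z u` almost everywhere, written
through the fundamental theorem of calculus. -/
structure IsSolution {N : ℕ} (V : ℝ → Matrix (Fin N) (Fin N) ℂ) (z : ℂ)
    (u u' : ℝ → Fin N → ℂ) : Prop where
  continuousOn : ContinuousOn u (Icc 0 1)
  continuousOn_deriv : ContinuousOn u' (Icc 0 1)
  integrable : IntervalIntegrable (fun t => V t *ᵥ u t - z • u t) volume 0 1
  eq_integral : ∀ x ∈ Icc (0 : ℝ) 1, u x = u 0 + ∫ t in (0 : ℝ)..x, u' t
  deriv_eq_integral : ∀ x ∈ Icc (0 : ℝ) 1,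
    u' x = u' 0 + ∫ t in (0 : ℝ)..x, (V t *ᵥ u t - z • u t)

/-- A matrix-valued solution: each column is a solution. -/
def IsMatrixSolution {N : ℕ} (V : ℝ → Matrix (Fin N) (Fin N) ℂ) (z : ℂ)
    (Y Y' : ℝ → Matrix (Fin N) (Fin N) ℂ) : Prop :=
  ∀ j, IsSolution V z (fun x i => Y x i j) (fun x i => Y' x i j)

theorem IsSolution.add {N : ℕ} {V : ℝ → Matrix (Fin N) (Fin N) ℂ} {z : ℂ}
    {u u' v v' : ℝ → Fin N → ℂ} (hu : IsSolution V z u u') (hv : IsSolution V z v v') :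
    IsSolution V z (u + v) (u' + v') := by
  have key : (fun t => V t *ᵥ (u + v) t - z • (u + v) t)
      = fun t => (V t *ᵥ u t - z • u t) + (V t *ᵥ v t - z • v t) := by
    funext t
    simp only [Pi.add_apply, Matrix.mulVec_add, smul_add]
    abel
  have sub : ∀ x ∈ Icc (0 : ℝ) 1, uIcc (0 : ℝ) x ⊆ Icc 0 1 := fun x hx => by
    rw [uIcc_of_le hx.1]; exact Icc_subset_Icc_right hx.2
  have sub' : ∀ x ∈ Icc (0 : ℝ) 1, uIcc (0 : ℝ) x ⊆ uIcc 0 1 := fun x hx => by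
    rw [uIcc_of_le (zero_le_one' ℝ)]; exact sub x hx
  refine ⟨hu.1.add hv.1, hu.2.add hv.2, ?_, fun x hx => ?_, fun x hx => ?_⟩
  · rw [key]; exact hu.3.add hv.3
  · have h1 : IntervalIntegrable u' volume 0 x := (hu.2.mono (sub x hx)).intervalIntegrable
    have h2 : IntervalIntegrable v' volume 0 x := (hv.2.mono (sub x hx)).intervalIntegrable
    have h3 : ∫ t in (0 : ℝ)..x, (u' + v') t
        = (∫ t in (0 : ℝ)..x, u' t) + ∫ t in (0 : ℝ)..x, v' t :=
      intervalIntegral.integral_add h1 h2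
    rw [h3, Pi.add_apply, Pi.add_apply, hu.4 x hx, hv.4 x hx]
    abel
  · rw [key, intervalIntegral.integral_add (hu.3.mono_set (sub' x hx))
      (hv.3.mono_set (sub' x hx)), Pi.add_apply, Pi.add_apply, hu.5 x hx, hv.5 x hx]
    abel

theorem IsSolution.smul {N : ℕ} {V : ℝ → Matrix (Fin N) (Fin N) ℂ} {z : ℂ}
    {u u' : ℝ → Fin N → ℂ} (c : ℂ) (hu : IsSolution V z u u') :
    IsSolution V z (c • u) (c • u') := by
  have key : (fun t => V t *ᵥ (c • u) t - z • (c • u) t)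
      = fun t => c • (V t *ᵥ u t - z • u t) := by
    funext t
    simp only [Pi.smul_apply, Matrix.mulVec_smul, smul_sub, smul_comm z c]
  refine ⟨hu.1.const_smul c, hu.2.const_smul c, ?_, fun x hx => ?_, fun x hx => ?_⟩
  · rw [key]; exact hu.3.smul c
  · have h3 : ∫ t in (0 : ℝ)..x, (c • u') t = c • ∫ t in (0 : ℝ)..x, u' t :=
      intervalIntegral.integral_smul c u'
    rw [h3, Pi.smul_apply, Pi.smul_apply, hu.4 x hx, smul_add]
  · rw [key, intervalIntegral.integral_smul, Pi.smul_apply, Pi.smul_apply, hu.5 x hx, smul_add]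

theorem IsSolution.zero {N : ℕ} (V : ℝ → Matrix (Fin N) (Fin N) ℂ) (z : ℂ) :
    IsSolution V z 0 0 := by
  refine ⟨continuousOn_const, continuousOn_const, ?_, fun x _ => ?_, fun x _ => ?_⟩ <;> simp

/-- The space of functions `ψ : [0,1] → ℂ^N` with `-ψ'' + V ψ = z ψ`, `ψ(0) = ψ(1) = 0`, that is,
the eigenspace for `z` of the Dirichlet operator `H ψ = -ψ'' + V ψ`. -/
def dirichletEigenspace {N : ℕ} (V : ℝ → Matrix (Fin N) (Fin N) ℂ) (z : ℂ) :
    Submodule ℂ (Icc (0 : ℝ) 1 → Fin N → ℂ) where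
  carrier := {ψ | ∃ u u' : ℝ → Fin N → ℂ,
    IsSolution V z u u' ∧ u 0 = 0 ∧ u 1 = 0 ∧ ∀ x : Icc (0 : ℝ) 1, ψ x = u x}
  add_mem' := by
    rintro ψ₁ ψ₂ ⟨u, u', hu, hu0, hu1, h1⟩ ⟨v, v', hv, hv0, hv1, h2⟩
    exact ⟨u + v, u' + v', hu.add hv, by simp [hu0, hv0], by simp [hu1, hv1],
      fun x => by simp [h1, h2]⟩
  zero_mem' := ⟨0, 0, IsSolution.zero V z, rfl, rfl, fun _ => rfl⟩
  smul_mem' := by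
    rintro c ψ ⟨u, u', hu, hu0, hu1, h⟩
    exact ⟨c • u, c • u', hu.smul c, by simp [hu0], by simp [hu1], fun x => by simp [h]⟩

/-- `z` is an eigenvalue of the Dirichlet problem for `V`. -/
def IsEigenvalue {N : ℕ} (V : ℝ → Matrix (Fin N) (Fin N) ℂ) (z : ℂ) : Prop :=
  dirichletEigenspace V z ≠ ⊥

/-- The multiplicity of `z` as an eigenvalue (`0` if it is not an eigenvalue). -/
def multiplicity {N : ℕ} (V : ℝ → Matrix (Fin N) (Fin N) ℂ) (z : ℂ) : ℕ :=
  Module.finrank ℂ (dirichletEigenspace V z)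

/-- `W ∈ Iso(V)`: `W = W* ∈ L¹(0,1)` has the same eigenvalues as `V`, with the same
multiplicities. -/
structure IsIsospectral {N : ℕ} (V W : ℝ → Matrix (Fin N) (Fin N) ℂ) : Prop where
  isPotential : IsPotential W
  eigenvalue_iff : ∀ z : ℂ, IsEigenvalue W z ↔ IsEigenvalue V z
  multiplicity_eq : ∀ z : ℂ, multiplicity W z = multiplicity V z

/-- The pair `(φ, φ')` on `[0,1]`, where `φ(·, z)` is the matrix solution with `φ(0) = 0` and
`φ'(0) = I`. -/
def phiPair {N : ℕ} (V : ℝ → Matrix (Fin N) (Fin N) ℂ) (z : ℂ) :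
    (ℝ → Matrix (Fin N) (Fin N) ℂ) × (ℝ → Matrix (Fin N) (Fin N) ℂ) :=
  Classical.epsilon fun p => IsMatrixSolution V z p.1 p.2 ∧ p.1 0 = 0 ∧ p.2 0 = 1

/-- The matrix solution `φ(x, z)` with `φ(0, z) = 0`, `φ'(0, z) = I`. -/
def phi {N : ℕ} (V : ℝ → Matrix (Fin N) (Fin N) ℂ) (z : ℂ) (x : ℝ) : Matrix (Fin N) (Fin N) ℂ :=
  (phiPair V z).1 x

/-- The pair `(χ, χ')` on `[0,1]`, where `χ(·, z)` is the matrix solution with `χ(1) = 0` and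
`χ'(1) = I`. -/
def chiPair {N : ℕ} (V : ℝ → Matrix (Fin N) (Fin N) ℂ) (z : ℂ) :
    (ℝ → Matrix (Fin N) (Fin N) ℂ) × (ℝ → Matrix (Fin N) (Fin N) ℂ) :=
  Classical.epsilon fun p => IsMatrixSolution V z p.1 p.2 ∧ p.1 1 = 0 ∧ p.2 1 = 1

/-- The Weyl-Titchmarsh function `m(z) = χ'(0, z) χ(0, z)⁻¹`. -/
def weyl {N : ℕ} (V : ℝ → Matrix (Fin N) (Fin N) ℂ) (z : ℂ) : Matrix (Fin N) (Fin N) ℂ :=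
  (chiPair V z).2 0 * ((chiPair V z).1 0)⁻¹

/-- The residue of `f` at an isolated singularity `c`: the integral `(2πi)⁻¹ ∮ f` over small
circles around `c` (it does not depend on the radius once this is small). -/
def residue (f : ℂ → ℂ) (c : ℂ) : ℂ :=
  limUnder (𝓝[>] (0 : ℝ)) fun r => (2 * (Real.pi : ℂ) * Complex.I)⁻¹ * ∮ z in C(c, r), f z

/-- `B_α = - res m` at the point `c = λ_α`, entry by entry. -/
def weylB {N : ℕ} (V : ℝ → Matrix (Fin N) (Fin N) ℂ) (c : ℂ) : Matrix (Fin N) (Fin N) ℂ :=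
  Matrix.of fun i j => - residue (fun z => weyl V z i j) c

/-- `S(x, z) = ∫₀ˣ φ(t, z)* φ(t, z) dt`. -/
def S {N : ℕ} (V : ℝ → Matrix (Fin N) (Fin N) ℂ) (z : ℂ) (x : ℝ) : Matrix (Fin N) (Fin N) ℂ :=
  Matrix.of fun i j => ∫ t in (0 : ℝ)..x, ((phi V z t)ᴴ * phi V z t) i j

/-- `E_α = Ker φ(1, λ_α) ⊆ ℂ^N`. -/
def E {N : ℕ} (V : ℝ → Matrix (Fin N) (Fin N) ℂ) (z : ℂ) :
    Submodule ℂ (EuclideanSpace ℂ (Fin N)) :=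
  LinearMap.ker (Matrix.toEuclideanLin (phi V z 1))

/-- The forbidden subspace `F_α = ℂ^N ⊖ S_α(E_α)`, where `S_α = S_α(1)`. -/
def F {N : ℕ} (V : ℝ → Matrix (Fin N) (Fin N) ℂ) (z : ℂ) :
    Submodule ℂ (EuclideanSpace ℂ (Fin N)) :=
  ((E V z).map (Matrix.toEuclideanLin (S V z 1)))ᗮ

/-- `ℂ^N ⊖ Ker B`. -/
def coKer {N : ℕ} (B : Matrix (Fin N) (Fin N) ℂ) : Submodule ℂ (EuclideanSpace ℂ (Fin N)) :=
  (LinearMap.ker (Matrix.toEuclideanLin B))ᗮ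

/-- `K(x) = A (I + S_α(x) A)⁻¹`, where `A = B - B_α` and `z = λ_α`. -/
def K {N : ℕ} (V : ℝ → Matrix (Fin N) (Fin N) ℂ) (z : ℂ) (B : Matrix (Fin N) (Fin N) ℂ)
    (x : ℝ) : Matrix (Fin N) (Fin N) ℂ :=
  (B - weylB V z) * (1 + S V z x * (B - weylB V z))⁻¹

/-- `φ_α(x) K(x) φ_α(x)*`. -/
def phiKphi {N : ℕ} (V : ℝ → Matrix (Fin N) (Fin N) ℂ) (z : ℂ) (B : Matrix (Fin N) (Fin N) ℂ)
    (x : ℝ) : Matrix (Fin N) (Fin N) ℂ :=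
  phi V z x * K V z B x * (phi V z x)ᴴ

/-- The transformed potential `V - 2 (φ_α K φ_α*)'`; the derivative is taken entry by entry on
`[0,1]` (one-sided at the end points). -/
def tildeV {N : ℕ} (V : ℝ → Matrix (Fin N) (Fin N) ℂ) (z : ℂ) (B : Matrix (Fin N) (Fin N) ℂ)
    (x : ℝ) : Matrix (Fin N) (Fin N) ℂ :=
  V x - (2 : ℂ) • Matrix.of fun i j => derivWithin (fun t => phiKphi V z B t i j) (Icc 0 1) x

/-- `W' ∈ L¹(0,1)`: `W` is absolutely continuous on `[0,1]`, with integrable derivative. -/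
def HasIntegrableDeriv {N : ℕ} (W : ℝ → Matrix (Fin N) (Fin N) ℂ) : Prop :=
  ∃ W' : ℝ → Matrix (Fin N) (Fin N) ℂ,
    (∀ i j, IntegrableOn (fun x => W' x i j) (Ioo (0 : ℝ) 1)) ∧
    ∀ x ∈ Icc (0 : ℝ) 1, ∀ i j, W x i j = W 0 i j + ∫ t in (0 : ℝ)..x, W' t i j

end

end SturmLiouville

/-! The passage from V to Ṽ is a double commutation. Write λ = λ_α, φ = φ_α, S = S_α, A = B − B_α, R
= (I + AS)⁻¹, η = φR and 𝒫 = ηAφ* = φKφ*. From S' = φ*φ and φ*φ' = φ'*φ, a direct computation shows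
that η solves the equation with potential V − 2𝒫' at λ, and that for z ≠ λ every solution y for V
yields the solution y + ηAw for V − 2𝒫', where w = (z − λ)⁻¹(φ*y' − φ'*y) (`solvesODE_commEta`,
`solvesODE_transform`).

The spectral data are then read off at the end points, where φ(0) = 0, φ'(0) = I and, crucially,
𝒫(1) = 0. The transform of χ still vanishes at 1, whence m̃ = m − (z − λ)⁻¹A (`weyl_commV`), which
gives all the residues. The transform of φ(·, z) takes at 1 the value (I − Q)φ(1, z) with Q² = 0, so
the kernels at z ≠ λ do not move (`E_commV_of_ne`). At λ itself φ̃ = η and S̃(1) = S(1)R(1), so Ẽ =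
R(1)⁻¹E and S̃(1)Ẽ = S(1)E; hence F is unchanged.

The conditions on B work because B_α is the pseudo-inverse of the compression of S(1) to E = Ker
φ(1) (`exists_weyl_limit`). By a dimension count they also say Ker B ∩ S(1)E = 0. In
`admissible_spec` this gives the invertibility of I + S(x)A, through a sum of three nonnegative
quadratic forms (`isUnit_det_one_add_mul`), then 𝒫(1) = 0, and finally (I + AS(1))e = BS(1)e on E,
which places Ẽ inside the orthogonal complement of Ker B; the dimensions agree.

Since V is only integrable, the equation is understood in the Carathéodory sense; existence,
uniqueness and continuity in z come from inverting a Volterra operator. Analyticity in z is never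
needed: the residue is obtained from the limit of (z − λ)m(z). -/

namespace SturmLiouville

/-! ### Absolutely continuous functions on [0,1] as primitives. -/

section Primitive

variable {E : Type*} [NormedAddCommGroup E] [NormedSpace ℝ E]

/-- `f` is absolutely continuous on `[0,1]` with derivative `g ∈ L¹(0,1)`, expressed through the
fundamental theorem of calculus. -/
structure IsPrimitive (f g : ℝ → E) : Prop where
  integrable : IntervalIntegrable g volume 0 1
  eq_integral : ∀ x ∈ Icc (0 : ℝ) 1, f x = f 0 + ∫ t in (0 : ℝ)..x, g t

theorem intervalIntegrable_of_mem {E : Type*} [NormedAddCommGroup E] {g : ℝ → E}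
    (hg : IntervalIntegrable g volume 0 1) {a b : ℝ} (ha : a ∈ Icc (0 : ℝ) 1) (hb : b ∈ Icc (0 : ℝ) 1) :
    IntervalIntegrable g volume a b :=
  hg.mono_set (by rw [uIcc_of_le (zero_le_one' ℝ)]; exact uIcc_subset_Icc ha hb)

theorem intervalIntegrable_of_continuousOn {E : Type*} [NormedAddCommGroup E] {g : ℝ → E}
    (hg : ContinuousOn g (Icc 0 1)) :
    IntervalIntegrable g volume 0 1 :=
  ContinuousOn.intervalIntegrable (by rwa [uIcc_of_le (zero_le_one' ℝ)])

theorem zero_mem_Icc : (0 : ℝ) ∈ Icc (0 : ℝ) 1 := ⟨le_rfl, zero_le_one⟩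

theorem one_mem_Icc : (1 : ℝ) ∈ Icc (0 : ℝ) 1 := ⟨zero_le_one, le_rfl⟩

theorem ae_restrict_uIoc_of_ae_Ioo {p : ℝ → Prop} (h : ∀ᵐ x ∂volume.restrict (Ioo (0 : ℝ) 1), p x)
    {x : ℝ} (hx : x ∈ Icc (0 : ℝ) 1) : ∀ᵐ t ∂volume.restrict (uIoc 0 x), p t := by
  rw [uIoc_of_le hx.1]
  refine ae_restrict_of_ae_restrict_of_subset (Ioc_subset_Ioc_right hx.2) ?_
  rwa [restrict_Ioo_eq_restrict_Ioc] at h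

theorem intervalIntegrable_congr_Ioo {E : Type*} [NormedAddCommGroup E] {g g' : ℝ → E}
    (hg : IntervalIntegrable g volume 0 1)
    (h : ∀ᵐ x ∂volume.restrict (Ioo (0 : ℝ) 1), g x = g' x) : IntervalIntegrable g' volume 0 1 :=
  hg.congr_ae (ae_restrict_uIoc_of_ae_Ioo h one_mem_Icc)

theorem integral_congr_Ioo {g g' : ℝ → E}
    (h : ∀ᵐ x ∂volume.restrict (Ioo (0 : ℝ) 1), g x = g' x) {x : ℝ} (hx : x ∈ Icc (0 : ℝ) 1) :
    ∫ t in (0 : ℝ)..x, g t = ∫ t in (0 : ℝ)..x, g' t :=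
  intervalIntegral.integral_congr_ae_restrict (ae_restrict_uIoc_of_ae_Ioo h hx)

theorem ae_Ioo_of_forall_Icc {p : ℝ → Prop} (h : ∀ x ∈ Icc (0 : ℝ) 1, p x) :
    ∀ᵐ x ∂volume.restrict (Ioo (0 : ℝ) 1), p x :=
  (ae_restrict_iff' measurableSet_Ioo).2 (ae_of_all _ fun x hx => h x ⟨hx.1.le, hx.2.le⟩)

namespace IsPrimitive

variable {f g f' g' : ℝ → E}

theorem sub_eq_integral (h : IsPrimitive f g) {a b : ℝ} (ha : a ∈ Icc (0 : ℝ) 1)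
    (hb : b ∈ Icc (0 : ℝ) 1) : f b - f a = ∫ t in a..b, g t := by
  rw [h.eq_integral a ha, h.eq_integral b hb, add_sub_add_left_eq_sub,
    intervalIntegral.integral_interval_sub_left (intervalIntegrable_of_mem h.integrable
      zero_mem_Icc hb) (intervalIntegrable_of_mem h.integrable zero_mem_Icc ha)]

theorem congr (h : IsPrimitive f g) (hf : ∀ x ∈ Icc (0 : ℝ) 1, f x = f' x)
    (hg : ∀ᵐ x ∂volume.restrict (Ioo (0 : ℝ) 1), g x = g' x) : IsPrimitive f' g' :=
  ⟨intervalIntegrable_congr_Ioo h.integrable hg, fun x hx => by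
    rw [← hf x hx, ← hf 0 zero_mem_Icc, h.eq_integral x hx, integral_congr_Ioo hg hx]⟩

theorem continuousOn (h : IsPrimitive f g) : ContinuousOn f (Icc 0 1) := by
  have h1 : ContinuousOn (fun x => f 0 + ∫ t in (0 : ℝ)..x, g t) (Icc 0 1) := by
    refine continuousOn_const.add ?_
    have := intervalIntegral.continuousOn_primitive_interval' (μ := volume) (b₁ := 0) (b₂ := 1)
      (a := 0) h.integrable left_mem_uIcc
    rwa [uIcc_of_le (zero_le_one' ℝ)] at this
  exact h1.congr h.eq_integral

theorem add (h : IsPrimitive f g) (h' : IsPrimitive f' g') :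
    IsPrimitive (fun x => f x + f' x) (fun x => g x + g' x) := by
  refine ⟨h.integrable.add h'.integrable, fun x hx => ?_⟩
  rw [intervalIntegral.integral_add (intervalIntegrable_of_mem h.integrable zero_mem_Icc hx)
    (intervalIntegrable_of_mem h'.integrable zero_mem_Icc hx), h.eq_integral x hx,
    h'.eq_integral x hx]
  abel

theorem clm {F : Type*} [NormedAddCommGroup F] [NormedSpace ℝ F] [CompleteSpace E]
    [CompleteSpace F] (L : E →L[ℝ] F)
    (h : IsPrimitive f g) : IsPrimitive (fun x => L (f x)) (fun x => L (g x)) := by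
  refine ⟨⟨L.integrable_comp h.integrable.1, L.integrable_comp h.integrable.2⟩, fun x hx => ?_⟩
  rw [L.intervalIntegral_comp_comm (intervalIntegrable_of_mem h.integrable zero_mem_Icc hx),
    h.eq_integral x hx, map_add]

theorem neg (h : IsPrimitive f g) : IsPrimitive (fun x => -f x) (fun x => -g x) := by
  refine ⟨h.integrable.neg, fun x hx => ?_⟩
  rw [intervalIntegral.integral_neg, h.eq_integral x hx, neg_add]

theorem sub (h : IsPrimitive f g) (h' : IsPrimitive f' g') :
    IsPrimitive (fun x => f x - f' x) (fun x => g x - g' x) := by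
  simpa only [sub_eq_add_neg] using h.add h'.neg

theorem add_const (h : IsPrimitive f g) (c : E) : IsPrimitive (fun x => f x + c) g := by
  refine ⟨h.integrable, fun x hx => ?_⟩
  rw [h.eq_integral x hx]
  abel

theorem hasDerivWithinAt [CompleteSpace E] (h : IsPrimitive f g) (hg : ContinuousOn g (Icc 0 1)) :
    ∀ x ∈ Icc (0 : ℝ) 1, HasDerivWithinAt f (g x) (Icc 0 1) x := by
  intro x hx
  have : Fact (x ∈ Icc (0 : ℝ) 1) := ⟨hx⟩
  have h1 : HasDerivWithinAt (fun u => ∫ t in (0 : ℝ)..u, g t) (g x) (Icc 0 1) x :=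
    intervalIntegral.integral_hasDerivWithinAt_right
      (intervalIntegrable_of_mem h.integrable zero_mem_Icc hx)
      (hg.stronglyMeasurableAtFilter_nhdsWithin measurableSet_Icc x) (hg x hx)
  exact (h1.const_add (f 0)).congr h.eq_integral (h.eq_integral x hx)

theorem of_hasDerivWithinAt [CompleteSpace E]
    (h : ∀ x ∈ Icc (0 : ℝ) 1, HasDerivWithinAt f (g x) (Icc 0 1) x)
    (hg : ContinuousOn g (Icc 0 1)) : IsPrimitive f g := by
  have hi := intervalIntegrable_of_continuousOn hg
  refine ⟨hi, fun x hx => ?_⟩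
  have := intervalIntegral.integral_eq_sub_of_hasDerivAt_of_le (f := f) (f' := g) hx.1
    (fun y hy => ((h y ⟨hy.1, hy.2.trans hx.2⟩).continuousWithinAt).mono
      (Icc_subset_Icc_right hx.2))
    (fun y hy => (h y ⟨hy.1.le, hy.2.le.trans hx.2⟩).hasDerivAt
      (Icc_mem_nhds hy.1 (hy.2.trans_le hx.2)))
    (intervalIntegrable_of_mem hi zero_mem_Icc hx)
  rw [this]
  abel

theorem eq_of_primitive_zero (h : IsPrimitive f fun _ => 0) {x : ℝ} (hx : x ∈ Icc (0 : ℝ) 1) :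
    f x = f 0 := by
  simpa using h.eq_integral x hx

theorem ae_hasDerivAt [CompleteSpace E] (h : IsPrimitive f g) :
    ∀ᵐ x, x ∈ Ioo (0 : ℝ) 1 → HasDerivAt f (g x) x := by
  filter_upwards [h.integrable.ae_hasDerivAt_integral] with x hx hx1
  rw [uIcc_of_le (zero_le_one' ℝ)] at hx
  have h1 := (hx ⟨hx1.1.le, hx1.2.le⟩ 0 zero_mem_Icc).const_add (f 0)
  refine h1.congr_of_eventuallyEq ?_
  filter_upwards [Icc_mem_nhds hx1.1 hx1.2] with y hy using h.eq_integral y hy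

end IsPrimitive

/-- The primitive of `k` is absolutely continuous and its increments dominate those of `h`. In the
product rule this serves both for the product and for the primitive of its expected derivative. -/
theorem absolutelyContinuousOnInterval_of_norm_sub_le {E : Type*} [NormedAddCommGroup E]
    {h : ℝ → E} {k : ℝ → ℝ} (hk : IntervalIntegrable k volume 0 1)
    (H : ∀ a ∈ Icc (0 : ℝ) 1, ∀ b ∈ Icc (0 : ℝ) 1, a ≤ b → ‖h b - h a‖ ≤ ∫ t in a..b, k t) :
    AbsolutelyContinuousOnInterval h 0 1 := by
  have hG := hk.absolutelyContinuousOnInterval_intervalIntegral (c := 0) left_mem_uIcc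
  rw [absolutelyContinuousOnInterval_iff] at hG ⊢
  intro ε hε
  obtain ⟨δ, hδ, h1⟩ := hG ε hε
  refine ⟨δ, hδ, fun e he hlt => lt_of_le_of_lt (Finset.sum_le_sum fun i hi => ?_) (h1 e he hlt)⟩
  have key : ∀ a ∈ Icc (0 : ℝ) 1, ∀ b ∈ Icc (0 : ℝ) 1, a ≤ b → dist (h a) (h b) ≤
      dist (∫ t in (0 : ℝ)..a, k t) (∫ t in (0 : ℝ)..b, k t) := fun a ha b hb hab => by
    rw [dist_eq_norm', Real.dist_eq, abs_sub_comm, intervalIntegral.integral_interval_sub_left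
      (intervalIntegrable_of_mem hk zero_mem_Icc hb)
      (intervalIntegrable_of_mem hk zero_mem_Icc ha)]
    exact (H a ha b hb hab).trans (le_abs_self _)
  have hm := he.1 i hi
  rw [uIcc_of_le (zero_le_one' ℝ)] at hm
  rcases le_total (e.2 i).1 (e.2 i).2 with hle | hle
  · exact key _ hm.1 _ hm.2 hle
  · rw [dist_comm, dist_comm (∫ t in (0 : ℝ)..(e.2 i).1, k t)]
    exact key _ hm.2 _ hm.1 hle

theorem IsPrimitive.norm_sub_le {f g : ℝ → E} (h : IsPrimitive f g) {a b : ℝ}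
    (ha : a ∈ Icc (0 : ℝ) 1) (hb : b ∈ Icc (0 : ℝ) 1) (hab : a ≤ b) :
    ‖f b - f a‖ ≤ ∫ t in a..b, ‖g t‖ := by
  rw [h.sub_eq_integral ha hb]
  exact intervalIntegral.norm_integral_le_integral_norm hab

end Primitive

/-! ### The product rule for absolutely continuous functions. -/

section Product

variable {𝔸 : Type*} [NormedRing 𝔸] [NormedAlgebra ℝ 𝔸]

theorem intervalIntegrable_mul_continuousOn {𝔸 : Type*} [NormedRing 𝔸] {f g : ℝ → 𝔸}
    (hf : IntervalIntegrable f volume 0 1)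
    (hg : ContinuousOn g (Icc 0 1)) : IntervalIntegrable (fun x => f x * g x) volume 0 1 :=
  hf.mul_continuousOn (by rwa [uIcc_of_le (zero_le_one' ℝ)])

theorem intervalIntegrable_continuousOn_mul {𝔸 : Type*} [NormedRing 𝔸] {f g : ℝ → 𝔸}
    (hf : IntervalIntegrable f volume 0 1)
    (hg : ContinuousOn g (Icc 0 1)) : IntervalIntegrable (fun x => g x * f x) volume 0 1 :=
  hf.continuousOn_mul (by rwa [uIcc_of_le (zero_le_one' ℝ)])

/-- Product rule for absolutely continuous functions with values in a Banach algebra. -/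
theorem IsPrimitive.mul [CompleteSpace 𝔸] {u v f g : ℝ → 𝔸} (hu : IsPrimitive u f)
    (hv : IsPrimitive v g) :
    IsPrimitive (fun x => u x * v x) (fun x => f x * v x + u x * g x) := by
  have hint : IntervalIntegrable (fun x => f x * v x + u x * g x) volume 0 1 :=
    (intervalIntegrable_mul_continuousOn hu.integrable hv.continuousOn).add
      (intervalIntegrable_continuousOn_mul hv.integrable hu.continuousOn)
  have hw : IsPrimitive (fun x => ∫ t in (0 : ℝ)..x, (f t * v t + u t * g t))
      (fun x => f x * v x + u x * g x) := ⟨hint, fun x _ => by simp⟩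
  obtain ⟨C, hC⟩ := isCompact_Icc.exists_bound_of_continuousOn hu.continuousOn
  obtain ⟨D, hD⟩ := isCompact_Icc.exists_bound_of_continuousOn hv.continuousOn
  -- The product and the primitive of `f v + u g` are both absolutely continuous and have the same
  -- derivative almost everywhere, so their difference is constant.
  have ac1 : AbsolutelyContinuousOnInterval (fun x => u x * v x) 0 1 := by
    refine absolutelyContinuousOnInterval_of_norm_sub_le
      (k := fun t => D * ‖f t‖ + C * ‖g t‖)
      ((hu.integrable.norm.const_mul D).add (hv.integrable.norm.const_mul C)) ?_
    intro a ha b hb hab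
    have e : u b * v b - u a * v a = (u b - u a) * v b + u a * (v b - v a) := by
      rw [sub_mul, mul_sub]; abel
    rw [e, intervalIntegral.integral_add
      ((intervalIntegrable_of_mem hu.integrable ha hb).norm.const_mul D)
      ((intervalIntegrable_of_mem hv.integrable ha hb).norm.const_mul C),
      intervalIntegral.integral_const_mul, intervalIntegral.integral_const_mul]
    refine (norm_add_le _ _).trans (add_le_add ?_ ?_)
    · refine (norm_mul_le _ _).trans ?_
      rw [mul_comm D]
      exact mul_le_mul (hu.norm_sub_le ha hb hab) (hD b hb) (norm_nonneg _)
        ((norm_nonneg _).trans (hu.norm_sub_le ha hb hab))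
    · refine (norm_mul_le _ _).trans ?_
      exact mul_le_mul (hC a ha) (hv.norm_sub_le ha hb hab) (norm_nonneg _)
        ((norm_nonneg _).trans (hC a ha))
  have ac2 := absolutelyContinuousOnInterval_of_norm_sub_le hw.integrable.norm
    fun a ha b hb hab => hw.norm_sub_le ha hb hab
  have h0 : ∀ᵐ x : ℝ, x ≠ 0 := by simp [ae_iff, measure_singleton]
  have h1 : ∀ᵐ x : ℝ, x ≠ 1 := by simp [ae_iff, measure_singleton]
  obtain ⟨c, hc⟩ := (ac1.fun_sub ac2).const_of_ae_hasDerivAt_zero (by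
    filter_upwards [hu.ae_hasDerivAt, hv.ae_hasDerivAt, hw.ae_hasDerivAt, h0, h1]
      with x hux hvx hwx hx0 hx1 hx
    rw [uIcc_of_le (zero_le_one' ℝ)] at hx
    have hx' : x ∈ Ioo (0 : ℝ) 1 := ⟨lt_of_le_of_ne hx.1 hx0.symm, lt_of_le_of_ne hx.2 hx1⟩
    simpa using ((hux hx').mul (hvx hx')).fun_sub (hwx hx'))
  rw [uIcc_of_le (zero_le_one' ℝ)] at hc
  refine ⟨hint, fun x hx => ?_⟩
  have e := (hc x hx).trans (hc 0 zero_mem_Icc).symm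
  simp only [intervalIntegral.integral_same, sub_zero] at e
  rw [← e]
  abel

theorem IsPrimitive.const_mul [CompleteSpace 𝔸] {u f : ℝ → 𝔸} (a : 𝔸) (hu : IsPrimitive u f) :
    IsPrimitive (fun x => a * u x) (fun x => a * f x) :=
  hu.clm (ContinuousLinearMap.mul ℝ 𝔸 a)

theorem IsPrimitive.mul_const [CompleteSpace 𝔸] {u f : ℝ → 𝔸} (a : 𝔸) (hu : IsPrimitive u f) :
    IsPrimitive (fun x => u x * a) (fun x => f x * a) :=
  hu.clm ((ContinuousLinearMap.mul ℝ 𝔸).flip a)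

end Product

/-! ### Volterra operators and their quasi-nilpotence. -/

noncomputable section Volterra

variable {𝔸 : Type*} [NormedRing 𝔸]

/-- The continuous extension to `ℝ` of a continuous function on `[0,1]`. -/
def extend (u : C(Icc (0 : ℝ) 1, 𝔸)) (t : ℝ) : 𝔸 := u (projIcc 0 1 zero_le_one t)

theorem continuous_extend (u : C(Icc (0 : ℝ) 1, 𝔸)) : Continuous (extend u) :=
  u.continuous.comp continuous_projIcc

theorem extend_of_mem (u : C(Icc (0 : ℝ) 1, 𝔸)) {t : ℝ} (ht : t ∈ Icc (0 : ℝ) 1) :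
    extend u t = u ⟨t, ht⟩ := by
  rw [extend, projIcc_of_mem]

theorem norm_extend_le (u : C(Icc (0 : ℝ) 1, 𝔸)) (t : ℝ) : ‖extend u t‖ ≤ ‖u‖ :=
  u.norm_coe_le_norm _

theorem monotoneOn_integral_norm_mul {Q : ℝ → 𝔸} (hQ : IntervalIntegrable Q volume 0 1)
    {k : ℝ → ℝ} (hk : ContinuousOn k (Icc 0 1)) (hk0 : ∀ t ∈ Icc (0 : ℝ) 1, 0 ≤ k t) {s x : ℝ}
    (hs : 0 ≤ s) (hsx : s ≤ x) (hx : x ≤ 1) :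
    ∫ t in (0 : ℝ)..s, ‖Q t‖ * k t ≤ ∫ t in (0 : ℝ)..x, ‖Q t‖ * k t :=
  intervalIntegral.integral_mono_interval le_rfl hs hsx
    ((ae_restrict_iff' measurableSet_Ioc).2 (ae_of_all _ fun t ht =>
      mul_nonneg (norm_nonneg _) (hk0 t ⟨ht.1.le, ht.2.trans hx⟩)))
    (intervalIntegrable_of_mem (intervalIntegrable_mul_continuousOn hQ.norm hk) zero_mem_Icc
      ⟨hs.trans hsx, hx⟩)

variable [NormedAlgebra ℂ 𝔸]

theorem isPrimitive_integral [CompleteSpace 𝔸] {Q : ℝ → 𝔸} (hQ : IntervalIntegrable Q volume 0 1)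
    (u : C(Icc (0 : ℝ) 1, 𝔸)) :
    IsPrimitive (fun x => ∫ t in (0 : ℝ)..x, Q t * extend u t) (fun t => Q t * extend u t) :=
  ⟨intervalIntegrable_mul_continuousOn hQ (continuous_extend u).continuousOn, fun x _ => by simp⟩

theorem norm_integral_le_integral_norm_mul {Q : ℝ → 𝔸} (hQ : IntervalIntegrable Q volume 0 1)
    {v : ℝ → 𝔸} {k : ℝ → ℝ} (hk : ContinuousOn k (Icc 0 1)) {x : ℝ} (hx : x ∈ Icc (0 : ℝ) 1)
    (hv : ∀ t ∈ Icc (0 : ℝ) x, ‖v t‖ ≤ k t) :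
    ‖∫ t in (0 : ℝ)..x, Q t * v t‖ ≤ ∫ t in (0 : ℝ)..x, ‖Q t‖ * k t := by
  refine intervalIntegral.norm_integral_le_of_norm_le hx.1 (ae_of_all _ fun t ht => ?_)
    (intervalIntegrable_of_mem (intervalIntegrable_mul_continuousOn hQ.norm hk) zero_mem_Icc hx)
  exact (norm_mul_le _ _).trans
    (mul_le_mul_of_nonneg_left (hv t ⟨ht.1.le, ht.2⟩) (norm_nonneg _))

variable [CompleteSpace 𝔸]

/-- The Volterra operator `u ↦ ∫₀ˣ Q u`. -/
def volterra (Q : ℝ → 𝔸) (hQ : IntervalIntegrable Q volume 0 1) :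
    C(Icc (0 : ℝ) 1, 𝔸) →L[ℂ] C(Icc (0 : ℝ) 1, 𝔸) :=
  LinearMap.mkContinuous
    { toFun := fun u => ⟨fun x => ∫ t in (0 : ℝ)..x, Q t * extend u t,
        (isPrimitive_integral hQ u).continuousOn.comp_continuous continuous_subtype_val
          fun x => x.2⟩
      map_add' := fun u v => by
        ext x
        change ∫ t in (0 : ℝ)..x, Q t * extend (u + v) t =
          (∫ t in (0 : ℝ)..x, Q t * extend u t) + ∫ t in (0 : ℝ)..x, Q t * extend v t
        rw [← intervalIntegral.integral_add
          (intervalIntegrable_of_mem (isPrimitive_integral hQ u).integrable zero_mem_Icc x.2)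
          (intervalIntegrable_of_mem (isPrimitive_integral hQ v).integrable zero_mem_Icc x.2)]
        simp [extend, mul_add]
      map_smul' := fun c u => by
        ext x
        change ∫ t in (0 : ℝ)..x, Q t * extend (c • u) t = c • ∫ t in (0 : ℝ)..x, Q t * extend u t
        rw [← intervalIntegral.integral_smul]
        simp [extend] }
    (∫ t in (0 : ℝ)..1, ‖Q t‖) (fun u => by
      have h1 : ∀ y ∈ Icc (0 : ℝ) 1, ∫ t in (0 : ℝ)..y, ‖Q t‖ * ‖u‖ ≤
          (∫ t in (0 : ℝ)..1, ‖Q t‖) * ‖u‖ := fun y hy => by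
        rw [← intervalIntegral.integral_mul_const]
        exact monotoneOn_integral_norm_mul hQ continuousOn_const (fun _ _ => norm_nonneg _) hy.1
          hy.2 le_rfl
      refine (ContinuousMap.norm_le _ ?_).2 fun x => ?_
      · exact mul_nonneg (intervalIntegral.integral_nonneg zero_le_one fun _ _ => norm_nonneg _)
          (norm_nonneg _)
      · exact (norm_integral_le_integral_norm_mul hQ continuousOn_const x.2
          fun t _ => norm_extend_le u t).trans (h1 x x.2))

theorem volterra_apply {Q : ℝ → 𝔸} (hQ : IntervalIntegrable Q volume 0 1)
    (u : C(Icc (0 : ℝ) 1, 𝔸)) (x : Icc (0 : ℝ) 1) :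
    volterra Q hQ u x = ∫ t in (0 : ℝ)..x, Q t * extend u t := rfl

theorem isPrimitive_pow {m f : ℝ → ℝ} (h : IsPrimitive m f) (n : ℕ) :
    IsPrimitive (fun x => m x ^ (n + 1)) (fun x => (n + 1) * (f x * m x ^ n)) := by
  induction n with
  | zero => simpa using h
  | succ n ih =>
    refine (ih.mul h).congr (fun x _ => (pow_succ _ _).symm) (ae_of_all _ fun x => ?_)
    push_cast
    ring

/-- With m(x) = ∫₀ˣ ‖Q‖, one has ∫₀ˣ ‖Q‖ mⁿ = m(x)ⁿ⁺¹/(n+1), which produces the factorial. The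
additional plain integration over [0,x] costs only a factor x ≤ 1. -/
theorem norm_volterra_comp_pow_le {Q : ℝ → 𝔸} (hQ : IntervalIntegrable Q volume 0 1)
    (h1 : IntervalIntegrable (fun _ : ℝ => (1 : 𝔸)) volume 0 1) (n : ℕ)
    (u : C(Icc (0 : ℝ) 1, 𝔸)) (x : Icc (0 : ℝ) 1) :
    ‖((volterra _ h1 * volterra Q hQ) ^ n) u x‖ ≤
      (∫ t in (0 : ℝ)..x, ‖Q t‖) ^ n * ((n.factorial : ℝ)⁻¹ * ‖u‖) := by
  have hm : IsPrimitive (fun x => ∫ t in (0 : ℝ)..x, ‖Q t‖) (fun t => ‖Q t‖) :=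
    ⟨hQ.norm, fun x _ => by simp⟩
  have hm0 : ∀ t ∈ Icc (0 : ℝ) 1, 0 ≤ ∫ s in (0 : ℝ)..t, ‖Q s‖ := fun t ht =>
    intervalIntegral.integral_nonneg ht.1 fun _ _ => norm_nonneg _
  induction n generalizing x with
  | zero => simpa using u.norm_coe_le_norm x
  | succ n ih =>
    set c : ℝ := (n.factorial : ℝ)⁻¹ * ‖u‖ with hc
    have hc0 : 0 ≤ c := by positivity
    set v := ((volterra _ h1 * volterra Q hQ) ^ n) u with hv
    have hk : ContinuousOn (fun t => (∫ s in (0 : ℝ)..t, ‖Q s‖) ^ n * c) (Icc 0 1) :=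
      (hm.continuousOn.pow n).mul continuousOn_const
    have hk0 : ∀ t ∈ Icc (0 : ℝ) 1, 0 ≤ (∫ s in (0 : ℝ)..t, ‖Q s‖) ^ n * c := fun t ht =>
      mul_nonneg (pow_nonneg (hm0 t ht) n) hc0
    have e : ((volterra _ h1 * volterra Q hQ) ^ (n + 1)) u x =
        ∫ s in (0 : ℝ)..x, extend (volterra Q hQ v) s := by
      rw [pow_succ']
      change volterra _ h1 (volterra Q hQ v) x = _
      simp [volterra_apply]
    have b : ∀ s ∈ Icc (0 : ℝ) x, ‖extend (volterra Q hQ v) s‖ ≤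
        ∫ t in (0 : ℝ)..x, ‖Q t‖ * ((∫ s in (0 : ℝ)..t, ‖Q s‖) ^ n * c) := fun s hs => by
      have hs1 : s ∈ Icc (0 : ℝ) 1 := ⟨hs.1, hs.2.trans x.2.2⟩
      rw [extend_of_mem _ hs1, volterra_apply]
      refine (norm_integral_le_integral_norm_mul hQ hk hs1 fun t ht => ?_).trans
        (monotoneOn_integral_norm_mul hQ hk hk0 hs.1 hs.2 x.2.2)
      rw [extend_of_mem v ⟨ht.1, ht.2.trans hs1.2⟩]
      exact ih ⟨t, ht.1, ht.2.trans hs1.2⟩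
    have I : ∫ t in (0 : ℝ)..x, ‖Q t‖ * ((∫ s in (0 : ℝ)..t, ‖Q s‖) ^ n * c) =
        (∫ t in (0 : ℝ)..x, ‖Q t‖) ^ (n + 1) * (((n + 1).factorial : ℝ)⁻¹ * ‖u‖) := by
      have h2 := (isPrimitive_pow hm n).eq_integral x x.2
      simp only [intervalIntegral.integral_same, ne_eq, Nat.succ_ne_zero, not_false_eq_true,
        zero_pow, zero_add, intervalIntegral.integral_const_mul] at h2
      simp only [← mul_assoc, intervalIntegral.integral_mul_const]
      rw [h2, hc, Nat.factorial_succ]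
      push_cast
      field_simp
    rw [e, ← I]
    have h0 : 0 ≤ ∫ t in (0 : ℝ)..x, ‖Q t‖ * ((∫ s in (0 : ℝ)..t, ‖Q s‖) ^ n * c) :=
      intervalIntegral.integral_nonneg x.2.1 fun t ht =>
        mul_nonneg (norm_nonneg _) (hk0 t ⟨ht.1, ht.2.trans x.2.2⟩)
    refine (intervalIntegral.norm_integral_le_of_norm_le_const
      (C := ∫ t in (0 : ℝ)..x, ‖Q t‖ * ((∫ s in (0 : ℝ)..t, ‖Q s‖) ^ n * c))
      fun s hs => ?_).trans ?_
    · rw [uIoc_of_le x.2.1] at hs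
      exact b s ⟨hs.1.le, hs.2⟩
    · rw [sub_zero, abs_of_nonneg x.2.1]
      exact mul_le_of_le_one_right h0 x.2.2

/-- 1 − Tⁿ is the product of 1 − T and a geometric sum; these commute, and a product of commuting
elements is a unit only if both factors are. -/
theorem isUnit_one_sub_of_pow {R : Type*} [Ring R] {T : R} {n : ℕ} (h : IsUnit (1 - T ^ n)) :
    IsUnit (1 - T) := by
  have hc : Commute (1 - T) (∑ i ∈ Finset.range n, T ^ i) :=
    ((Commute.one_left _).sub_left (Finset.sum_induction _ (Commute T)
      (fun _ _ => Commute.add_right)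
      (Commute.zero_right _) fun i _ => Commute.self_pow T i))
  rw [← mul_neg_geom_sum, hc.isUnit_mul_iff] at h
  exact h.1

/-- The operator need not be a contraction, but its n-th power has norm at most Mⁿ/n! with M = ∫₀¹
‖Q‖, which is below 1 for some n. -/
theorem isUnit_one_sub_volterra {Q : ℝ → 𝔸} (hQ : IntervalIntegrable Q volume 0 1)
    (h1 : IntervalIntegrable (fun _ : ℝ => (1 : 𝔸)) volume 0 1) :
    IsUnit (1 - volterra _ h1 * volterra Q hQ) := by
  set M := ∫ t in (0 : ℝ)..1, ‖Q t‖ with hM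
  have hM0 : 0 ≤ M := intervalIntegral.integral_nonneg zero_le_one fun _ _ => norm_nonneg _
  have hlim := FloorSemiring.tendsto_pow_div_factorial_atTop M
  obtain ⟨n, hn⟩ := ((hlim.eventually (gt_mem_nhds zero_lt_one))).exists
  refine isUnit_one_sub_of_pow (n := n) (isUnit_one_sub_of_norm_lt_one
    (x := (volterra _ h1 * volterra Q hQ) ^ n) (lt_of_le_of_lt ?_ hn))
  refine ContinuousLinearMap.opNorm_le_bound _ (by positivity) fun u => ?_
  refine (ContinuousMap.norm_le _ (by positivity)).2 fun x => ?_
  refine (norm_volterra_comp_pow_le hQ h1 n u x).trans ?_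
  rw [div_eq_mul_inv, mul_assoc]
  have hx : ∫ t in (0 : ℝ)..x, ‖Q t‖ ≤ M := by
    simpa using monotoneOn_integral_norm_mul (k := fun _ => 1) hQ continuousOn_const
      (fun _ _ => zero_le_one) x.2.1 x.2.2 le_rfl
  have hx0 : 0 ≤ ∫ t in (0 : ℝ)..x, ‖Q t‖ :=
    intervalIntegral.integral_nonneg x.2.1 fun _ _ => norm_nonneg _
  gcongr

end Volterra

/-! ### The equation y'' = Qy: uniqueness, existence, dependence on the spectral parameter. -/

noncomputable section SecondOrder

variable {𝔸 : Type*} [NormedRing 𝔸] [NormedAlgebra ℂ 𝔸]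

/-- `y'' = Q y` on `[0,1]` in the Carathéodory sense, where `y` and `Q` take values in a
Banach algebra. -/
structure SolvesODE (Q y y' : ℝ → 𝔸) : Prop where
  fst : IsPrimitive y y'
  snd : IsPrimitive y' fun t => Q t * y t

theorem intervalIntegrable_sub_smul_one {V : ℝ → 𝔸} (hV : IntervalIntegrable V volume 0 1)
    (z : ℂ) : IntervalIntegrable (fun t => V t - z • (1 : 𝔸)) volume 0 1 :=
  hV.sub intervalIntegrable_const

namespace SolvesODE

variable {Q y y' v v' : ℝ → 𝔸}

theorem sub (h : SolvesODE Q y y') (h' : SolvesODE Q v v') :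
    SolvesODE Q (fun x => y x - v x) (fun x => y' x - v' x) :=
  ⟨h.fst.sub h'.fst, by simpa only [mul_sub] using h.snd.sub h'.snd⟩

theorem congr_ae {Q' : ℝ → 𝔸} (h : SolvesODE Q y y')
    (hQ : ∀ᵐ x ∂volume.restrict (Ioo (0 : ℝ) 1), Q x = Q' x) : SolvesODE Q' y y' :=
  ⟨h.fst, h.snd.congr (fun _ _ => rfl) (hQ.mono fun x hx => by rw [hx])⟩

/-- The sign is placed on y because −y(1 − x) has derivative y'(1 − x). Data at 1 become data at 0
and the condition y'(1) = 1 keeps its sign, so statements about the right end reduce to the left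
end. -/
theorem reflect (h : SolvesODE Q y y') :
    SolvesODE (fun x => Q (1 - x)) (fun x => -y (1 - x)) (fun x => y' (1 - x)) := by
  have key : ∀ {f g : ℝ → 𝔸}, IsPrimitive f g →
      IsPrimitive (fun x => f (1 - x)) (fun x => -g (1 - x)) := by
    intro f g hfg
    refine ⟨?_, fun x hx => ?_⟩
    · have := (hfg.integrable.comp_sub_left 1).symm
      rw [sub_zero, sub_self] at this
      exact this.neg
    · have hx' : 1 - x ∈ Icc (0 : ℝ) 1 := ⟨by linarith [hx.2], by linarith [hx.1]⟩
      have := hfg.sub_eq_integral hx' one_mem_Icc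
      rw [intervalIntegral.integral_neg, intervalIntegral.integral_comp_sub_left (fun t => g t) 1,
        sub_zero, ← this]
      abel
  refine ⟨?_, ?_⟩
  · simpa using (key h.fst).neg
  · simpa using key h.snd

variable [CompleteSpace 𝔸]

theorem mul_const (h : SolvesODE Q y y') (a : 𝔸) :
    SolvesODE Q (fun x => y x * a) (fun x => y' x * a) :=
  ⟨h.fst.mul_const a, by simpa only [mul_assoc] using h.snd.mul_const a⟩

/-- Integrating twice with zero data makes y a fixed point of the double Volterra operator T; since
1 − T is invertible, y = 0, and then y' = ∫ Qy = 0. -/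
theorem eq_zero (hQ : IntervalIntegrable Q volume 0 1) (h : SolvesODE Q y y') (h0 : y 0 = 0)
    (h0' : y' 0 = 0) : ∀ x ∈ Icc (0 : ℝ) 1, y x = 0 ∧ y' x = 0 := by
  have h1 : IntervalIntegrable (fun _ : ℝ => (1 : 𝔸)) volume 0 1 := intervalIntegrable_const
  let u : C(Icc (0 : ℝ) 1, 𝔸) := ⟨fun x => y x, h.fst.continuousOn.comp_continuous
    continuous_subtype_val fun x => x.2⟩
  have hu : ∀ t ∈ Icc (0 : ℝ) 1, extend u t = y t := fun t ht => extend_of_mem u ht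
  have hy' : ∀ x ∈ Icc (0 : ℝ) 1, y' x = ∫ t in (0 : ℝ)..x, Q t * extend u t := fun x hx => by
    rw [h.snd.eq_integral x hx, h0', zero_add]
    refine intervalIntegral.integral_congr fun t ht => ?_
    rw [uIcc_of_le hx.1] at ht
    simp only [hu t ⟨ht.1, ht.2.trans hx.2⟩]
  have hfix : (1 - volterra _ h1 * volterra Q hQ) u = 0 := by
    ext x
    change u x - volterra _ h1 (volterra Q hQ u) x = 0
    rw [volterra_apply, sub_eq_zero]
    change y x = _
    rw [h.fst.eq_integral x x.2, h0, zero_add]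
    refine intervalIntegral.integral_congr fun t ht => ?_
    rw [uIcc_of_le x.2.1] at ht
    have ht1 : t ∈ Icc (0 : ℝ) 1 := ⟨ht.1, ht.2.trans x.2.2⟩
    simp only [one_mul, extend_of_mem _ ht1, volterra_apply, hy' t ht1]
  have hu0 : u = 0 := by
    obtain ⟨r, hr⟩ := (isUnit_one_sub_volterra hQ h1).exists_left_inv
    have : (r * (1 - volterra _ h1 * volterra Q hQ)) u = 0 := by
      change r ((1 - volterra _ h1 * volterra Q hQ) u) = 0
      rw [hfix, map_zero]
    rwa [hr] at this
  refine fun x hx => ⟨?_, ?_⟩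
  · rw [← hu x hx, hu0]; rfl
  · rw [hy' x hx, hu0]
    simp [extend]

theorem unique (hQ : IntervalIntegrable Q volume 0 1) (h : SolvesODE Q y y')
    (h' : SolvesODE Q v v') (h0 : y 0 = v 0) (h0' : y' 0 = v' 0) :
    ∀ x ∈ Icc (0 : ℝ) 1, y x = v x ∧ y' x = v' x := by
  intro x hx
  have := (h.sub h').eq_zero hQ (sub_eq_zero.2 h0) (sub_eq_zero.2 h0') x hx
  exact ⟨sub_eq_zero.1 this.1, sub_eq_zero.1 this.2⟩

theorem unique_right (hQ : IntervalIntegrable Q volume 0 1) (h : SolvesODE Q y y')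
    (h' : SolvesODE Q v v') (h1 : y 1 = v 1) (h1' : y' 1 = v' 1) :
    ∀ x ∈ Icc (0 : ℝ) 1, y x = v x ∧ y' x = v' x := by
  intro x hx
  have hQ' : IntervalIntegrable (fun x => Q (1 - x)) volume 0 1 := by
    simpa using (hQ.comp_sub_left 1).symm
  have := h.reflect.unique hQ' h'.reflect (by simp [h1]) (by simp [h1']) (1 - x)
    ⟨by linarith [hx.2], by linarith [hx.1]⟩
  simpa using this

end SolvesODE

variable [CompleteSpace 𝔸]

/-- Puts the spectral parameter in affine position, so that inverting the operator gives continuous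
dependence on it. -/
theorem volterra_sub_smul {V : ℝ → 𝔸} (hV : IntervalIntegrable V volume 0 1)
    (h1 : IntervalIntegrable (fun _ : ℝ => (1 : 𝔸)) volume 0 1) (z : ℂ) :
    volterra _ (intervalIntegrable_sub_smul_one hV z) = volterra V hV - z • volterra _ h1 := by
  ext u x
  change _ = volterra V hV u x - z • volterra _ h1 u x
  simp only [volterra_apply]
  have h2 : IntervalIntegrable (fun t => z • ((1 : 𝔸) * extend u t)) volume 0 x :=
    (intervalIntegrable_of_mem (isPrimitive_integral h1 u).integrable zero_mem_Icc x.2).smul z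
  rw [← intervalIntegral.integral_smul, ← intervalIntegral.integral_sub
    (intervalIntegrable_of_mem (isPrimitive_integral hV u).integrable zero_mem_Icc x.2) h2]
  simp [sub_mul]

/-- The solution is (1 − W(A₀ − zA₁))⁻¹ b, and inversion in a Banach algebra is continuous at units.
-/
theorem exists_continuous_solution {B : Type*} [NormedAddCommGroup B] [NormedSpace ℂ B]
    [CompleteSpace B] (W A₀ A₁ : B →L[ℂ] B) (b : B) (h : ∀ z : ℂ, IsUnit (1 - W * (A₀ - z • A₁))) :
    ∃ U : ℂ → B, Continuous U ∧ ∀ z, U z = b + W ((A₀ - z • A₁) (U z)) := by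
  have hT : Continuous fun z : ℂ => 1 - W * (A₀ - z • A₁) := by fun_prop
  have hinv : Continuous fun z : ℂ => Ring.inverse (1 - W * (A₀ - z • A₁)) :=
    continuous_iff_continuousAt.2 fun z => by
      obtain ⟨w, hw⟩ := h z
      have := NormedRing.inverse_continuousAt w
      rw [hw] at this
      exact ContinuousAt.comp (f := fun z : ℂ => 1 - W * (A₀ - z • A₁)) this hT.continuousAt
  refine ⟨fun z => Ring.inverse (1 - W * (A₀ - z • A₁)) b, hinv.clm_apply continuous_const,
    fun z => ?_⟩
  have e : ((1 - W * (A₀ - z • A₁)) * Ring.inverse (1 - W * (A₀ - z • A₁))) b = b := by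
    rw [Ring.mul_inverse_cancel _ (h z)]; rfl
  exact sub_eq_iff_eq_add.1 e

/-- Existence of the solution with `y(0) = 0`, `y'(0) = 1`, continuous in the spectral
parameter. -/
theorem exists_solvesODE {V : ℝ → 𝔸} (hV : IntervalIntegrable V volume 0 1) :
    ∃ Y Y' : ℂ → ℝ → 𝔸, (∀ z, SolvesODE (fun t => V t - z • (1 : 𝔸)) (Y z) (Y' z)) ∧
      (∀ z, Y z 0 = 0) ∧ (∀ z, Y' z 0 = 1) ∧ Continuous (Function.uncurry Y) ∧
      Continuous fun z => Y' z 1 := by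
  have h1 : IntervalIntegrable (fun _ : ℝ => (1 : 𝔸)) volume 0 1 := intervalIntegrable_const
  have hz := intervalIntegrable_sub_smul_one hV
  -- `b` is the function x ↦ x·1, the contribution of the data y(0) = 0, y'(0) = 1 to the twice
  -- integrated equation.
  let b : C(Icc (0 : ℝ) 1, 𝔸) := volterra _ h1 1
  obtain ⟨U, hU, hUeq⟩ := exists_continuous_solution (volterra _ h1) (volterra V hV)
    (volterra _ h1) b fun z => by
      rw [← volterra_sub_smul hV h1 z]
      exact isUnit_one_sub_volterra (hz z) h1
  have hfix : ∀ z x, U z x = b x + volterra _ h1 (volterra _ (hz z) (U z)) x := by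
    intro z x
    have := hUeq z
    rw [← volterra_sub_smul hV h1 z] at this
    exact DFunLike.congr_fun this x
  let Y : ℂ → ℝ → 𝔸 := fun z => extend (U z)
  let Y' : ℂ → ℝ → 𝔸 := fun z x => 1 + ∫ t in (0 : ℝ)..x, (V t - z • (1 : 𝔸)) * extend (U z) t
  have hb : ∀ x : Icc (0 : ℝ) 1, b x = ∫ t in (0 : ℝ)..x, (1 : 𝔸) := fun x => by
    change volterra _ h1 1 x = _
    rw [volterra_apply]
    simp [extend]
  have hY0 : ∀ z, Y z 0 = 0 := fun z => by
    change extend (U z) 0 = 0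
    rw [extend_of_mem _ zero_mem_Icc, hfix, hb, volterra_apply]
    simp
  have hsnd : ∀ z, IsPrimitive (Y' z) fun t => (V t - z • (1 : 𝔸)) * Y z t := fun z => by
    have := (isPrimitive_integral (hz z) (U z)).add_const 1
    exact this.congr (fun x _ => add_comm _ _) (ae_of_all _ fun x => rfl)
  refine ⟨Y, Y', fun z => ⟨⟨intervalIntegrable_of_continuousOn (hsnd z).continuousOn, ?_⟩,
    hsnd z⟩, hY0, fun z => by simp [Y'], ?_, ?_⟩
  · intro x hx
    rw [hY0, zero_add]
    change extend (U z) x = _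
    rw [extend_of_mem _ hx, hfix, hb, volterra_apply, ← intervalIntegral.integral_add
      (intervalIntegrable_of_mem h1 zero_mem_Icc hx) (intervalIntegrable_of_mem
      (isPrimitive_integral h1 _).integrable zero_mem_Icc hx)]
    refine intervalIntegral.integral_congr fun t ht => ?_
    rw [uIcc_of_le hx.1] at ht
    simp only [one_mul, extend_of_mem _ (⟨ht.1, ht.2.trans hx.2⟩ : t ∈ Icc (0 : ℝ) 1),
      volterra_apply, Y']
  · have h2 : Continuous fun p : ℂ × ℝ => (U p.1, projIcc (0 : ℝ) 1 zero_le_one p.2) :=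
      (hU.comp continuous_fst).prodMk (continuous_projIcc.comp continuous_snd)
    exact continuous_eval.comp h2
  -- Y'(1) is also an operator affine in z, applied to the continuous family `U z` and evaluated at
  -- the point 1.
  · have h3 : ∀ z, Y' z 1 = 1 + (volterra V hV - z • volterra _ h1) (U z) ⟨1, one_mem_Icc⟩ := by
      intro z
      rw [← volterra_sub_smul hV h1 z, volterra_apply]
    simp only [h3]
    have h4 : Continuous fun z => (volterra V hV - z • volterra _ h1) (U z) :=
      ((volterra V hV).continuous.comp hU).sub
        (continuous_id.smul ((volterra _ h1).continuous.comp hU))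
    exact continuous_const.add ((continuous_eval_const (F := C(Icc (0 : ℝ) 1, 𝔸)) _).comp h4)

/-- Existence of the solution with `y(1) = 0`, `y'(1) = 1`, continuous in the spectral
parameter. -/
theorem exists_solvesODE_right {V : ℝ → 𝔸} (hV : IntervalIntegrable V volume 0 1) :
    ∃ Y Y' : ℂ → ℝ → 𝔸, (∀ z, SolvesODE (fun t => V t - z • (1 : 𝔸)) (Y z) (Y' z)) ∧
      (∀ z, Y z 1 = 0) ∧ (∀ z, Y' z 1 = 1) ∧ Continuous (Function.uncurry Y) ∧
      Continuous fun z => Y' z 0 := by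
  have hV' : IntervalIntegrable (fun x => V (1 - x)) volume 0 1 := by
    simpa using (hV.comp_sub_left 1).symm
  obtain ⟨Y, Y', h, h0, h0', hc, hc'⟩ := exists_solvesODE hV'
  refine ⟨fun z x => -Y z (1 - x), fun z x => Y' z (1 - x), fun z => ?_, fun z => by simp [h0],
    fun z => by simp [h0'], ?_, by simpa using hc'⟩
  · simpa using (h z).reflect
  · have h2 : Continuous fun p : ℂ × ℝ => (p.1, 1 - p.2) := by fun_prop
    exact (hc.comp h2).neg

end SecondOrder

/-! ### Matrix solutions φ and χ, and the eigenspaces in terms of Ker φ(1). -/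

noncomputable section MatrixSolutions

open scoped Matrix.Norms.L2Operator

variable {N : ℕ}

/-- The entry `(i, j)` of a matrix as a continuous linear functional. -/
def entryCLM (i j : Fin N) : Matrix (Fin N) (Fin N) ℂ →L[ℝ] ℂ :=
  LinearMap.toContinuousLinearMap
    { toFun := fun M => M i j
      map_add' := fun _ _ => rfl
      map_smul' := fun _ _ => rfl }

/-- The column `j` of a matrix as a continuous linear map. -/
def columnCLM (j : Fin N) : Matrix (Fin N) (Fin N) ℂ →L[ℝ] (Fin N → ℂ) :=
  LinearMap.toContinuousLinearMap
    { toFun := fun M i => M i j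
      map_add' := fun _ _ => rfl
      map_smul' := fun _ _ => rfl }

/-- The matrix with a single entry, as a continuous linear map of that entry. -/
def singleCLM (i j : Fin N) : ℂ →L[ℝ] Matrix (Fin N) (Fin N) ℂ :=
  LinearMap.toContinuousLinearMap
    { toFun := fun c => Matrix.single i j c
      map_add' := fun a b => Matrix.single_add i j a b
      map_smul' := fun r c => (Matrix.smul_single r i j c).symm }

theorem integral_apply {M : ℝ → Matrix (Fin N) (Fin N) ℂ} {a b : ℝ}
    (hM : IntervalIntegrable M volume a b) (i j : Fin N) :
    (∫ t in a..b, M t) i j = ∫ t in a..b, M t i j :=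
  ((entryCLM i j).intervalIntegral_comp_comm hM).symm

theorem intervalIntegrable_of_entries {M : ℝ → Matrix (Fin N) (Fin N) ℂ} {a b : ℝ}
    (hM : ∀ i j, IntervalIntegrable (fun t => M t i j) volume a b) :
    IntervalIntegrable M volume a b := by
  have e : M = ∑ i, ∑ j, fun t => singleCLM i j (M t i j) := by
    funext t
    rw [Finset.sum_apply]
    simp only [Finset.sum_apply]
    exact Matrix.matrix_eq_sum_single (M t)
  rw [e]
  refine IntervalIntegrable.sum _ fun i _ => IntervalIntegrable.sum _ fun j _ => ?_
  exact ⟨(singleCLM i j).integrable_comp (hM i j).1, (singleCLM i j).integrable_comp (hM i j).2⟩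

theorem IsPrimitive.of_entries {f g : ℝ → Matrix (Fin N) (Fin N) ℂ}
    (h : ∀ i j, IsPrimitive (fun x => f x i j) (fun x => g x i j)) : IsPrimitive f g := by
  have hg := intervalIntegrable_of_entries fun i j => (h i j).integrable
  refine ⟨hg, fun x hx => ?_⟩
  ext i j
  rw [Matrix.add_apply, integral_apply (intervalIntegrable_of_mem hg zero_mem_Icc hx)]
  exact (h i j).eq_integral x hx

theorem IsPrimitive.entry {f g : ℝ → Matrix (Fin N) (Fin N) ℂ} (h : IsPrimitive f g)
    (i j : Fin N) : IsPrimitive (fun x => f x i j) (fun x => g x i j) :=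
  h.clm (entryCLM i j)

theorem IsPrimitive.conjTranspose {f g : ℝ → Matrix (Fin N) (Fin N) ℂ} (h : IsPrimitive f g) :
    IsPrimitive (fun x => (f x)ᴴ) (fun x => (g x)ᴴ) :=
  h.clm (starL' ℝ : Matrix (Fin N) (Fin N) ℂ ≃L[ℝ] Matrix (Fin N) (Fin N) ℂ).toContinuousLinearMap

theorem sub_smul_one_mul_apply (M Y : Matrix (Fin N) (Fin N) ℂ) (z : ℂ) (i j : Fin N) :
    ((M - z • (1 : Matrix (Fin N) (Fin N) ℂ)) * Y) i j =
      (M *ᵥ (fun i => Y i j) - z • fun i => Y i j) i := by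
  rw [sub_mul, Matrix.smul_mul, one_mul]
  rfl

/-- Links columnwise vector solutions with the Banach algebra theory: Vy − zy is left multiplication
by V − z·1. -/
theorem isMatrixSolution_iff {V Y Y' : ℝ → Matrix (Fin N) (Fin N) ℂ} {z : ℂ} :
    IsMatrixSolution V z Y Y' ↔
      SolvesODE (fun t => V t - z • (1 : Matrix (Fin N) (Fin N) ℂ)) Y Y' := by
  refine ⟨fun h => ⟨IsPrimitive.of_entries fun i j => ⟨?_, fun x hx => ?_⟩,
    IsPrimitive.of_entries fun i j => ⟨?_, fun x hx => ?_⟩⟩, fun h j => ?_⟩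
  · refine intervalIntegrable_of_continuousOn ?_
    exact (continuous_apply i).comp_continuousOn (h j).continuousOn_deriv
  · have h1 := congrFun ((h j).eq_integral x hx) i
    have h2 := (ContinuousLinearMap.proj (R := ℝ)
      (φ := fun _ : Fin N => ℂ) i).intervalIntegral_comp_comm
      (intervalIntegrable_of_mem (intervalIntegrable_of_continuousOn (h j).continuousOn_deriv)
        zero_mem_Icc hx)
    rw [Pi.add_apply] at h1
    exact h1.trans (congrArg _ h2.symm)
  · simp only [sub_smul_one_mul_apply]
    let p := ContinuousLinearMap.proj (R := ℝ) (φ := fun _ : Fin N => ℂ) i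
    exact ⟨p.integrable_comp (h j).integrable.1, p.integrable_comp (h j).integrable.2⟩
  · simp only [sub_smul_one_mul_apply]
    have h1 := congrFun ((h j).deriv_eq_integral x hx) i
    have h2 := (ContinuousLinearMap.proj (R := ℝ)
      (φ := fun _ : Fin N => ℂ) i).intervalIntegral_comp_comm
      (intervalIntegrable_of_mem (h j).integrable zero_mem_Icc hx)
    rw [Pi.add_apply] at h1
    exact h1.trans (congrArg _ h2.symm)
  · have h1 := h.fst.clm (columnCLM j)
    have h2 := h.snd.clm (columnCLM j)
    have e : (fun t => columnCLM j ((V t - z • (1 : Matrix (Fin N) (Fin N) ℂ)) * Y t)) =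
        fun t => V t *ᵥ (fun i => Y t i j) - z • fun i => Y t i j := by
      funext t i
      exact sub_smul_one_mul_apply (V t) (Y t) z i j
    rw [e] at h2
    exact ⟨h1.continuousOn, h2.continuousOn, h2.integrable, h1.eq_integral, h2.eq_integral⟩

theorem IsPotential.intervalIntegrable {V : ℝ → Matrix (Fin N) (Fin N) ℂ} (hV : IsPotential V) :
    IntervalIntegrable V volume 0 1 :=
  intervalIntegrable_of_entries fun i j => by
    rw [intervalIntegrable_iff_integrableOn_Ioo_of_le zero_le_one]
    exact hV.integrable i j

/-- The derivative `φ'(x, z)`. -/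
def phiDeriv (V : ℝ → Matrix (Fin N) (Fin N) ℂ) (z : ℂ) (x : ℝ) : Matrix (Fin N) (Fin N) ℂ :=
  (phiPair V z).2 x

variable {V : ℝ → Matrix (Fin N) (Fin N) ℂ}

theorem phiPair_spec (hV : IntervalIntegrable V volume 0 1) (z : ℂ) :
    SolvesODE (fun t => V t - z • (1 : Matrix (Fin N) (Fin N) ℂ)) (phi V z) (phiDeriv V z) ∧
      phi V z 0 = 0 ∧ phiDeriv V z 0 = 1 := by
  obtain ⟨Y, Y', h, h0, h0', -, -⟩ := exists_solvesODE hV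
  have hex : ∃ p : (ℝ → Matrix (Fin N) (Fin N) ℂ) × (ℝ → Matrix (Fin N) (Fin N) ℂ),
      IsMatrixSolution V z p.1 p.2 ∧ p.1 0 = 0 ∧ p.2 0 = 1 :=
    ⟨(Y z, Y' z), isMatrixSolution_iff.2 (h z), h0 z, h0' z⟩
  have := Classical.epsilon_spec hex
  exact ⟨isMatrixSolution_iff.1 this.1, this.2.1, this.2.2⟩

theorem solvesODE_phi (hV : IntervalIntegrable V volume 0 1) (z : ℂ) :
    SolvesODE (fun t => V t - z • (1 : Matrix (Fin N) (Fin N) ℂ)) (phi V z) (phiDeriv V z) :=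
  (phiPair_spec hV z).1

theorem phi_zero (hV : IntervalIntegrable V volume 0 1) (z : ℂ) : phi V z 0 = 0 :=
  (phiPair_spec hV z).2.1

theorem phiDeriv_zero (hV : IntervalIntegrable V volume 0 1) (z : ℂ) : phiDeriv V z 0 = 1 :=
  (phiPair_spec hV z).2.2

theorem eq_phi_mul (hV : IntervalIntegrable V volume 0 1) {z : ℂ}
    {y y' : ℝ → Matrix (Fin N) (Fin N) ℂ}
    (hy : SolvesODE (fun t => V t - z • (1 : Matrix (Fin N) (Fin N) ℂ)) y y') (h0 : y 0 = 0) :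
    ∀ x ∈ Icc (0 : ℝ) 1, y x = phi V z x * y' 0 ∧ y' x = phiDeriv V z x * y' 0 :=
  hy.unique (intervalIntegrable_sub_smul_one hV z) ((solvesODE_phi hV z).mul_const (y' 0))
    (by rw [h0, phi_zero hV, zero_mul]) (by rw [phiDeriv_zero hV, one_mul])

theorem chiPair_spec (hV : IntervalIntegrable V volume 0 1) (z : ℂ) :
    SolvesODE (fun t => V t - z • (1 : Matrix (Fin N) (Fin N) ℂ)) (chiPair V z).1 (chiPair V z).2 ∧
      (chiPair V z).1 1 = 0 ∧ (chiPair V z).2 1 = 1 := by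
  obtain ⟨Y, Y', h, h0, h0', -, -⟩ := exists_solvesODE_right hV
  have hex : ∃ p : (ℝ → Matrix (Fin N) (Fin N) ℂ) × (ℝ → Matrix (Fin N) (Fin N) ℂ),
      IsMatrixSolution V z p.1 p.2 ∧ p.1 1 = 0 ∧ p.2 1 = 1 :=
    ⟨(Y z, Y' z), isMatrixSolution_iff.2 (h z), h0 z, h0' z⟩
  have := Classical.epsilon_spec hex
  exact ⟨isMatrixSolution_iff.1 this.1, this.2.1, this.2.2⟩

theorem eq_chi_mul (hV : IntervalIntegrable V volume 0 1) {z : ℂ}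
    {y y' : ℝ → Matrix (Fin N) (Fin N) ℂ}
    (hy : SolvesODE (fun t => V t - z • (1 : Matrix (Fin N) (Fin N) ℂ)) y y') (h1 : y 1 = 0) :
    ∀ x ∈ Icc (0 : ℝ) 1, y x = (chiPair V z).1 x * y' 1 ∧ y' x = (chiPair V z).2 x * y' 1 :=
  hy.unique_right (intervalIntegrable_sub_smul_one hV z)
    ((chiPair_spec hV z).1.mul_const (y' 1))
    (by rw [h1, (chiPair_spec hV z).2.1, zero_mul]) (by rw [(chiPair_spec hV z).2.2, one_mul])

theorem exists_continuous_chi (hV : IntervalIntegrable V volume 0 1) :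
    ∃ Y Y' : ℂ → ℝ → Matrix (Fin N) (Fin N) ℂ, Continuous (Function.uncurry Y) ∧
      (Continuous fun z => Y' z 0) ∧
      ∀ z, ∀ x ∈ Icc (0 : ℝ) 1, (chiPair V z).1 x = Y z x ∧ (chiPair V z).2 x = Y' z x := by
  obtain ⟨Y, Y', h, h0, h0', hc, hc'⟩ := exists_solvesODE_right hV
  refine ⟨Y, Y', hc, hc', fun z x hx => ?_⟩
  obtain ⟨h1, h2, h3⟩ := chiPair_spec hV z
  exact h1.unique_right (intervalIntegrable_sub_smul_one hV z) (h z) (by rw [h2, h0])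
    (by rw [h3, h0']) x hx

theorem S_eq_integral (hV : IntervalIntegrable V volume 0 1) (z : ℂ) {x : ℝ}
    (hx : x ∈ Icc (0 : ℝ) 1) :
    S V z x = ∫ t in (0 : ℝ)..x, (phi V z t)ᴴ * phi V z t := by
  have h := (solvesODE_phi hV z).fst
  ext i j
  rw [integral_apply]
  · rfl
  · exact intervalIntegrable_of_mem (intervalIntegrable_of_continuousOn
      (h.conjTranspose.continuousOn.mul h.continuousOn)) zero_mem_Icc hx

theorem S_zero (V : ℝ → Matrix (Fin N) (Fin N) ℂ) (z : ℂ) : S V z 0 = 0 := by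
  ext i j
  simp [S]

theorem isPrimitive_S (hV : IntervalIntegrable V volume 0 1) (z : ℂ) :
    IsPrimitive (S V z) fun t => (phi V z t)ᴴ * phi V z t := by
  have h := (solvesODE_phi hV z).fst
  refine ⟨intervalIntegrable_of_continuousOn (h.conjTranspose.continuousOn.mul h.continuousOn),
    fun x hx => ?_⟩
  rw [S_zero, zero_add, S_eq_integral hV z hx]

/-- `c ↦ φ(·, z) c` as a linear map into the functions on `[0,1]`. -/
def phiLin (V : ℝ → Matrix (Fin N) (Fin N) ℂ) (z : ℂ) :
    EuclideanSpace ℂ (Fin N) →ₗ[ℂ] (Icc (0 : ℝ) 1 → Fin N → ℂ) where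
  toFun c x := phi V z x *ᵥ c.ofLp
  map_add' a b := by
    funext x
    simp [Matrix.mulVec_add]
  map_smul' a b := by
    funext x
    simp [Matrix.mulVec_smul]

/-- The square matrix all of whose columns are `u`. -/
def constColumns (u : Fin N → ℂ) : Matrix (Fin N) (Fin N) ℂ := Matrix.of fun i _ => u i

theorem mul_constColumns (M : Matrix (Fin N) (Fin N) ℂ) (u : Fin N → ℂ) :
    M * constColumns u = constColumns (M *ᵥ u) := rfl

theorem constColumns_injective : Function.Injective (constColumns (N := N)) := by
  intro u v h
  funext i
  exact congrFun (congrFun h i) i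

theorem IsSolution.solvesODE {z : ℂ} {u u' : ℝ → Fin N → ℂ} (h : IsSolution V z u u') :
    SolvesODE (fun t => V t - z • (1 : Matrix (Fin N) (Fin N) ℂ)) (fun x => constColumns (u x))
      (fun x => constColumns (u' x)) :=
  isMatrixSolution_iff.1 fun _ => h

theorem eq_phi_mulVec (hV : IntervalIntegrable V volume 0 1) {z : ℂ} {u u' : ℝ → Fin N → ℂ}
    (h : IsSolution V z u u') (h0 : u 0 = 0) :
    ∀ x ∈ Icc (0 : ℝ) 1, u x = phi V z x *ᵥ u' 0 := by
  intro x hx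
  have := (eq_phi_mul hV h.solvesODE (by rw [h0]; rfl) x hx).1
  rw [mul_constColumns] at this
  exact constColumns_injective this

theorem isSolution_phi_mulVec (hV : IntervalIntegrable V volume 0 1) (z : ℂ) (c : Fin N → ℂ) :
    IsSolution V z (fun x => phi V z x *ᵥ c) (fun x => phiDeriv V z x *ᵥ c) := by
  -- The vector solution is recovered as a column of a square matrix solution, which requires at
  -- least one column; N = 0 is trivial.
  rcases isEmpty_or_nonempty (Fin N) with hN | ⟨⟨j⟩⟩
  · have e : ∀ f : ℝ → Fin N → ℂ, f = 0 := fun f => by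
      funext x i
      exact hN.elim i
    rw [e fun x => phi V z x *ᵥ c, e fun x => phiDeriv V z x *ᵥ c]
    exact IsSolution.zero V z
  · exact isMatrixSolution_iff.2 ((solvesODE_phi hV z).mul_const (constColumns c)) j

/-- As φ'(0) = I, the vector c is the derivative at 0 of φ(·)c. -/
theorem phiLin_injective (hV : IntervalIntegrable V volume 0 1) (z : ℂ) :
    Function.Injective (phiLin V z) := by
  rw [← LinearMap.ker_eq_bot, LinearMap.ker_eq_bot']
  intro c hc
  have h := (solvesODE_phi hV z).mul_const (constColumns c.ofLp)
  have h1 := h.fst.hasDerivWithinAt h.snd.continuousOn 0 zero_mem_Icc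
  have hz : ∀ x ∈ Icc (0 : ℝ) 1, phi V z x * constColumns c.ofLp = 0 := fun x hx => by
    rw [mul_constColumns]
    have : phi V z x *ᵥ c.ofLp = 0 := congrFun hc ⟨x, hx⟩
    rw [this]
    rfl
  have h2 : HasDerivWithinAt (fun x => phi V z x * constColumns c.ofLp) 0 (Icc 0 1) 0 :=
    (hasDerivWithinAt_const 0 (Icc (0 : ℝ) 1) (0 : Matrix (Fin N) (Fin N) ℂ)).congr hz
      (hz 0 zero_mem_Icc)
  have h3 := (uniqueDiffOn_Icc zero_lt_one (0 : ℝ) zero_mem_Icc).eq_deriv _ h1 h2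
  rw [phiDeriv_zero hV, one_mul] at h3
  have h4 : c.ofLp = 0 := constColumns_injective h3
  ext i
  exact congrFun h4 i

theorem mem_E {z : ℂ} {c : EuclideanSpace ℂ (Fin N)} :
    c ∈ E V z ↔ phi V z 1 *ᵥ c.ofLp = 0 := by
  rw [E, LinearMap.mem_ker]
  constructor
  · intro h
    exact congrArg WithLp.ofLp h
  · intro h
    exact congrArg (WithLp.toLp 2) h

/-- A solution u with u(0) = 0 equals φ(·)u'(0), which leaves only the condition at 1.
Multiplicities thus become dimensions of Ker φ(1). -/
theorem dirichletEigenspace_eq_map (hV : IntervalIntegrable V volume 0 1) (z : ℂ) :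
    dirichletEigenspace V z = (E V z).map (phiLin V z) := by
  ext ψ
  constructor
  · rintro ⟨u, u', h, h0, h1, hψ⟩
    refine ⟨WithLp.toLp 2 (u' 0), ?_, ?_⟩
    · rw [SetLike.mem_coe, mem_E, ← eq_phi_mulVec hV h h0 1 one_mem_Icc, h1]
    · funext x
      rw [hψ x, eq_phi_mulVec hV h h0 x x.2]
      rfl
  · rintro ⟨c, hc, rfl⟩
    exact ⟨_, _, isSolution_phi_mulVec hV z c.ofLp, by simp [phi_zero hV], mem_E.1 hc,
      fun x => rfl⟩

theorem multiplicity_eq_finrank (hV : IntervalIntegrable V volume 0 1) (z : ℂ) :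
    multiplicity V z = Module.finrank ℂ (E V z) := by
  rw [multiplicity, dirichletEigenspace_eq_map hV]
  exact (Submodule.equivMapOfInjective _ (phiLin_injective hV z) (E V z)).finrank_eq.symm

theorem isEigenvalue_iff (hV : IntervalIntegrable V volume 0 1) (z : ℂ) :
    IsEigenvalue V z ↔ Module.finrank ℂ (E V z) ≠ 0 := by
  rw [IsEigenvalue, ← multiplicity_eq_finrank hV, multiplicity, not_iff_not,
    dirichletEigenspace_eq_map hV, Submodule.finrank_eq_zero]

end MatrixSolutions

/-! ### Projections, compressions and the invertibility criterion. -/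

noncomputable section LinearAlgebra

variable {N : ℕ}

theorem isUnit_det_of_injective {M : Matrix (Fin N) (Fin N) ℂ}
    (h : ∀ v : Fin N → ℂ, M *ᵥ v = 0 → v = 0) :
    IsUnit M.det := by
  rw [isUnit_iff_ne_zero]
  intro h0
  obtain ⟨v, hv, hMv⟩ := Matrix.exists_mulVec_eq_zero_iff.2 h0
  exact hv (h v hMv)

/-- The orthogonal projection `P` onto `Ker M`; its complement is `Mᴴ G` for some `G`. -/
theorem exists_ker_projection (M : Matrix (Fin N) (Fin N) ℂ) :
    ∃ P G : Matrix (Fin N) (Fin N) ℂ, Pᴴ = P ∧ P * P = P ∧ M * P = 0 ∧ Mᴴ * G = 1 - P := by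
  have hH : (Mᴴ * M).IsHermitian := Matrix.isHermitian_conjTranspose_mul_self M
  set U : Matrix (Fin N) (Fin N) ℂ := (hH.eigenvectorUnitary : Matrix (Fin N) (Fin N) ℂ) with hU
  set d : Fin N → ℂ := fun i => (hH.eigenvalues i : ℂ) with hd
  have hUU : Uᴴ * U = 1 := Matrix.mem_unitaryGroup_iff'.1 hH.eigenvectorUnitary.2
  have hUU' : U * Uᴴ = 1 := Matrix.mem_unitaryGroup_iff.1 hH.eigenvectorUnitary.2
  have hspec : Mᴴ * M = U * Matrix.diagonal d * Uᴴ := hH.spectral_theorem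
  have conj_mul : ∀ a b : Fin N → ℂ, (U * Matrix.diagonal a * Uᴴ) * (U * Matrix.diagonal b * Uᴴ) =
      U * Matrix.diagonal (fun i => a i * b i) * Uᴴ := fun a b => by
    rw [← Matrix.diagonal_mul_diagonal]
    calc _ = U * Matrix.diagonal a * (Uᴴ * U) * Matrix.diagonal b * Uᴴ := by
          simp only [Matrix.mul_assoc]
      _ = _ := by rw [hUU]; simp only [Matrix.mul_assoc, Matrix.mul_one]
  -- `p` marks the zero eigenvalues of MᴴM, so `P` projects onto Ker MᴴM = Ker M.
  set p : Fin N → ℂ := fun i => if hH.eigenvalues i = 0 then 1 else 0 with hp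
  set P : Matrix (Fin N) (Fin N) ℂ := U * Matrix.diagonal p * Uᴴ with hP
  have hPP : P * P = P := by
    rw [hP, conj_mul]
    congr 3
    funext i
    simp [hp]
  have hPH : Pᴴ = P := by
    rw [hP]
    simp only [Matrix.conjTranspose_mul, Matrix.conjTranspose_conjTranspose,
      Matrix.diagonal_conjTranspose, Matrix.mul_assoc]
    congr 3
    funext i
    simp only [hp, Pi.star_apply]
    split_ifs <;> simp
  have hHP : Mᴴ * M * P = 0 := by
    rw [hspec, hP, conj_mul]
    have : (fun i => d i * p i) = 0 := by
      funext i
      by_cases h : hH.eigenvalues i = 0 <;> simp [hd, hp, h]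
    rw [this]
    simp
  -- `G` is M times the pseudo-inverse of MᴴM; with the convention 0⁻¹ = 0 the product d·d⁻¹ is
  -- exactly 1 − p.
  refine ⟨P, M * (U * Matrix.diagonal (fun i => (d i)⁻¹) * Uᴴ), hPH, hPP, ?_, ?_⟩
  · rw [← Matrix.conjTranspose_mul_self_eq_zero, Matrix.conjTranspose_mul, Matrix.mul_assoc,
      ← Matrix.mul_assoc Mᴴ, hHP, Matrix.mul_zero]
  · rw [← Matrix.mul_assoc, hspec, conj_mul, eq_sub_iff_add_eq, hP, ← Matrix.add_mul,
      ← Matrix.mul_add, Matrix.diagonal_add]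
    have : (fun i => d i * (d i)⁻¹ + p i) = 1 := by
      funext i
      by_cases h : hH.eigenvalues i = 0 <;> simp [hd, hp, h]
    rw [this]
    simp [hUU']

/-- The compression of `S` to the range of a projection `P` has a Hermitian pseudo-inverse. -/
theorem exists_compression_inverse {S P : Matrix (Fin N) (Fin N) ℂ} (hS : S.PosDef)
    (hP : Pᴴ = P) (hPP : P * P = P) :
    IsUnit (S * P + (1 - P)) ∧ ∃ B : Matrix (Fin N) (Fin N) ℂ,
      B * (S * P + (1 - P)) = P ∧ Bᴴ = B ∧ P * B = B ∧
      B * S * P = P := by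
  have hdet : IsUnit (S * P + (1 - P)) := by
    rw [Matrix.isUnit_iff_isUnit_det]
    refine isUnit_det_of_injective fun v hv => ?_
    have h1 : P * (S * P + (1 - P)) = P * S * P := by
      rw [mul_add, mul_sub, mul_one, hPP, sub_self, add_zero, mul_assoc]
    have h2 : (P * S * P) *ᵥ v = 0 := by rw [← h1, ← Matrix.mulVec_mulVec, hv, Matrix.mulVec_zero]
    have h3 : P *ᵥ v = 0 := by
      by_contra hne
      have := hS.dotProduct_mulVec_pos hne
      rw [Matrix.star_mulVec, hP, ← Matrix.dotProduct_mulVec, Matrix.mulVec_mulVec,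
        Matrix.mulVec_mulVec, h2, dotProduct_zero] at this
      exact lt_irrefl _ this
    rw [Matrix.add_mulVec, ← Matrix.mulVec_mulVec, h3, Matrix.mulVec_zero, zero_add,
      Matrix.sub_mulVec, h3, sub_zero, Matrix.one_mulVec] at hv
    exact hv
  refine ⟨hdet, ?_⟩
  -- The pseudo-inverse is P M⁻¹; it is Hermitian because MᴴP = PSP = PM.
  set M := S * P + (1 - P) with hM
  obtain ⟨W, hMW⟩ := hdet.exists_right_inv
  obtain ⟨W', hWM⟩ := hdet.exists_left_inv
  have hW : W' = W := by rw [← mul_one W', ← hMW, ← mul_assoc, hWM, one_mul]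
  rw [hW] at hWM
  have hBM : P * W * M = P := by rw [mul_assoc, hWM, mul_one]
  refine ⟨P * W, hBM, ?_, by rw [← mul_assoc, hPP], ?_⟩
  · have h1 : Mᴴ * P = P * M := by
      rw [hM]
      simp only [Matrix.conjTranspose_add, Matrix.conjTranspose_mul, Matrix.conjTranspose_sub,
        Matrix.conjTranspose_one, hP, hS.isHermitian.eq]
      simp only [add_mul, sub_mul, mul_add, mul_sub, one_mul, mul_one, hPP, mul_assoc]
    have h2 : Mᴴ * (P * W) = P := by rw [← mul_assoc, h1, mul_assoc, hMW, mul_one]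
    have h3 : Wᴴ * Mᴴ = 1 := by rw [← Matrix.conjTranspose_mul, hMW, Matrix.conjTranspose_one]
    calc (P * W)ᴴ = Wᴴ * P := by rw [Matrix.conjTranspose_mul, hP]
      _ = Wᴴ * (Mᴴ * (P * W)) := by rw [h2]
      _ = P * W := by rw [← mul_assoc, h3, one_mul]
  · have h1 : P * W * M * P = P * W * S * P := by
      rw [hM]
      simp only [mul_add, add_mul, mul_sub, sub_mul, mul_one, mul_assoc, hPP, sub_self, add_zero]
    rw [← h1, hBM, hPP]

/-- The idea is the identity B + BSB + B'(T − S)B' = B(1 + S(B − B')) + (1 + (B − B')S)B', whose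
left side is a sum of nonnegative forms. If c is in the kernel of 1 + S(B − B'), the right side has
zero quadratic form at c, so each summand vanishes: Bc = 0 and TB'c = SB'c. Then c = SB'c = TB'c, so
BTB'c = 0, and the last hypothesis gives B'c = 0, hence c = 0. -/
theorem isUnit_det_one_add_mul {B B' S T : Matrix (Fin N) (Fin N) ℂ} (hB : B.PosSemidef)
    (hB' : B'ᴴ = B')
    (hS : S.PosSemidef) (hTS : (T - S).PosSemidef) (hBTB : B' * T * B' = B')
    (h : ∀ c, B *ᵥ (T *ᵥ (B' *ᵥ c)) = 0 → B' *ᵥ c = 0) :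
    IsUnit (1 + S * (B - B')).det := by
  refine isUnit_det_of_injective fun c hc => ?_
  have hadj : (1 + S * (B - B'))ᴴ = 1 + (B - B') * S := by
    simp [Matrix.conjTranspose_add, Matrix.conjTranspose_mul, hB', hB.isHermitian.eq,
      hS.isHermitian.eq]
  have e : B + B * S * B + B' * (T - S) * B' =
      B * (1 + S * (B - B')) + (1 + (B - B') * S) * B' := by
    rw [mul_sub, sub_mul, hBTB]
    simp only [mul_add, add_mul, mul_sub, sub_mul, mul_one, one_mul, mul_assoc]
    abel
  have h0 : star c ⬝ᵥ ((B + B * S * B + B' * (T - S) * B') *ᵥ c) = 0 := by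
    rw [e, Matrix.add_mulVec, ← Matrix.mulVec_mulVec, hc, Matrix.mulVec_zero, zero_add,
      ← Matrix.mulVec_mulVec, Matrix.dotProduct_mulVec, ← hadj, ← Matrix.star_mulVec, hc,
      star_zero, zero_dotProduct]
  have q : ∀ X Y : Matrix (Fin N) (Fin N) ℂ, Xᴴ = X → star c ⬝ᵥ ((X * Y * X) *ᵥ c) =
      star (X *ᵥ c) ⬝ᵥ (Y *ᵥ (X *ᵥ c)) := fun X Y hX => by
    rw [Matrix.star_mulVec, hX, ← Matrix.dotProduct_mulVec, Matrix.mulVec_mulVec,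
      Matrix.mulVec_mulVec]
  rw [Matrix.add_mulVec, Matrix.add_mulVec, dotProduct_add, dotProduct_add,
    q B S hB.isHermitian.eq, q B' (T - S) hB'] at h0
  have n1 := hB.dotProduct_mulVec_nonneg c
  have n2 := hS.dotProduct_mulVec_nonneg (B *ᵥ c)
  have n3 := hTS.dotProduct_mulVec_nonneg (B' *ᵥ c)
  have z3 := (add_eq_zero_iff_of_nonneg (add_nonneg n1 n2) n3).1 h0
  have z1 := (add_eq_zero_iff_of_nonneg n1 n2).1 z3.1
  have hBc := (hB.dotProduct_mulVec_zero_iff c).1 z1.1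
  have hTSb := (hTS.dotProduct_mulVec_zero_iff (B' *ᵥ c)).1 z3.2
  rw [Matrix.sub_mulVec, sub_eq_zero] at hTSb
  have hcb : c = T *ᵥ (B' *ᵥ c) := by
    rw [Matrix.add_mulVec, Matrix.one_mulVec, ← Matrix.mulVec_mulVec, Matrix.sub_mulVec, hBc,
      zero_sub, Matrix.mulVec_neg, ← hTSb, add_neg_eq_zero] at hc
    exact hc
  have := h c (by rw [← hcb, hBc])
  rw [hcb, this, Matrix.mulVec_zero]

end LinearAlgebra

/-! ### Residues from limits. -/

noncomputable section Residue

theorem residue_congr {f g : ℂ → ℂ} {c : ℂ} (h : f =ᶠ[𝓝[≠] c] g) : residue f c = residue g c := by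
  unfold residue limUnder
  congr 1
  refine Filter.map_congr ?_
  rw [eventuallyEq_nhdsWithin_iff, Metric.eventually_nhds_iff] at h
  obtain ⟨δ, hδ, h⟩ := h
  filter_upwards [Ioo_mem_nhdsGT hδ] with r hr
  rw [circleIntegral.integral_congr hr.1.le]
  intro z hz
  refine h ?_ ?_
  · rw [Metric.mem_sphere.1 hz]; exact hr.2
  · rintro rfl
    simp only [Metric.mem_sphere, dist_self] at hz
    exact hr.1.ne hz

/-- On the circle of radius r, f differs from b/(z − c) by o(1/r), and the length 2πr makes the
integral of the difference tend to 0. Continuity near c suffices; holomorphy is not used. -/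
theorem residue_eq_of_tendsto {f : ℂ → ℂ} {c b : ℂ} (hc : ∀ᶠ z in 𝓝[≠] c, ContinuousAt f z)
    (hf : Tendsto (fun z => (z - c) * f z) (𝓝[≠] c) (𝓝 b)) : residue f c = b := by
  refine Tendsto.limUnder_eq ?_
  rw [Metric.tendsto_nhds]
  intro ε hε
  have h1 : ∀ᶠ z in 𝓝[≠] c, dist ((z - c) * f z) b < ε / 2 :=
    (Metric.tendsto_nhds.1 hf) _ (half_pos hε)
  have h2 := hc.and h1
  rw [eventually_nhdsWithin_iff, Metric.eventually_nhds_iff] at h2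
  obtain ⟨δ, hδ, h⟩ := h2
  filter_upwards [Ioo_mem_nhdsGT hδ] with r hr
  have hz : ∀ z ∈ Metric.sphere c r, z ≠ c := by
    rintro z hz rfl
    simp only [Metric.mem_sphere, dist_self] at hz
    exact hr.1.ne hz
  have hz' : ∀ z ∈ Metric.sphere c r, ContinuousAt f z ∧ dist ((z - c) * f z) b < ε / 2 :=
    fun z hzs => h (by rw [Metric.mem_sphere.1 hzs]; exact hr.2) (hz z hzs)
  have i1 : CircleIntegrable f c r := ContinuousOn.circleIntegrable hr.1.le fun z hzs =>
    (hz' z hzs).1.continuousWithinAt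
  have i2 : CircleIntegrable (fun z => b * (z - c)⁻¹) c r :=
    ContinuousOn.circleIntegrable hr.1.le fun z hzs =>
      (continuousAt_const.mul ((continuousAt_id.sub continuousAt_const).inv₀
        (sub_ne_zero.2 (hz z hzs)))).continuousWithinAt
  have e : ((∮ z in C(c, r), f z) - ∮ z in C(c, r), b * (z - c)⁻¹) =
      ∮ z in C(c, r), (f z - b * (z - c)⁻¹) := (circleIntegral.integral_sub i1 i2).symm
  have hI : ∮ z in C(c, r), b * (z - c)⁻¹ = b * (2 * Real.pi * Complex.I) := by
    rw [circleIntegral.integral_const_mul, circleIntegral.integral_sub_center_inv c hr.1.ne']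
  have hpi : (2 * (Real.pi : ℂ) * Complex.I) ≠ 0 := Complex.two_pi_I_ne_zero
  have hbound : ‖∮ z in C(c, r), (f z - b * (z - c)⁻¹)‖ ≤ 2 * Real.pi * r * (ε / 2 / r) := by
    refine circleIntegral.norm_integral_le_of_norm_le_const hr.1.le fun z hzs => ?_
    have hzc := sub_ne_zero.2 (hz z hzs)
    have e1 : f z - b * (z - c)⁻¹ = ((z - c) * f z - b) * (z - c)⁻¹ := by
      field_simp
    rw [e1, norm_mul, norm_inv, ← dist_eq_norm, ← dist_eq_norm, Metric.mem_sphere.1 hzs,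
      ← div_eq_mul_inv]
    gcongr
    · exact hr.1.le
    · exact (hz' z hzs).2.le
  rw [← e, hI] at hbound
  rw [dist_eq_norm]
  have e2 : (2 * (Real.pi : ℂ) * Complex.I)⁻¹ * (∮ z in C(c, r), f z) - b =
      (2 * (Real.pi : ℂ) * Complex.I)⁻¹ *
        ((∮ z in C(c, r), f z) - b * (2 * Real.pi * Complex.I)) := by
    field_simp
  have hn : ‖(2 * (Real.pi : ℂ) * Complex.I)‖ = 2 * Real.pi := by
    simp [Real.pi_pos.le]
  rw [e2, norm_mul, norm_inv, hn]
  have hr0 : r ≠ 0 := hr.1.ne'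
  have hp := Real.pi_pos
  calc (2 * Real.pi)⁻¹ * _ ≤ (2 * Real.pi)⁻¹ * (2 * Real.pi * r * (ε / 2 / r)) := by gcongr
    _ = ε / 2 := by field_simp
    _ < ε := half_lt_self hε

end Residue

/-! ### Wronskian identities and positivity of S. -/

noncomputable section Spectral

open scoped Matrix.Norms.L2Operator

variable {N : ℕ} {V : ℝ → Matrix (Fin N) (Fin N) ℂ}

/-- The Wronskian `p* y' - p'* y` of solutions for a real and a complex spectral parameter. -/
theorem isPrimitive_wronskian (hV : IsPotential V) {lam : ℝ} {z : ℂ}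
    {p p' y y' : ℝ → Matrix (Fin N) (Fin N) ℂ}
    (hp : SolvesODE (fun t => V t - (lam : ℂ) • (1 : Matrix (Fin N) (Fin N) ℂ)) p p')
    (hy : SolvesODE (fun t => V t - z • (1 : Matrix (Fin N) (Fin N) ℂ)) y y') :
    IsPrimitive (fun x => (p x)ᴴ * y' x - (p' x)ᴴ * y x)
      (fun x => ((lam : ℂ) - z) • ((p x)ᴴ * y x)) := by
  refine ((hp.fst.conjTranspose.mul hy.snd).sub (hp.snd.conjTranspose.mul hy.fst)).congr
    (fun x _ => rfl) (hV.hermitian.mono fun x hx => ?_)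
  rw [Matrix.conjTranspose_mul, Matrix.conjTranspose_sub, hx.eq, Matrix.conjTranspose_smul,
    Matrix.conjTranspose_one, Complex.star_def, Complex.conj_ofReal]
  simp only [sub_mul, mul_sub, Matrix.smul_mul, Matrix.mul_smul, Matrix.one_mul, Matrix.mul_one,
    sub_smul, Matrix.mul_assoc]
  abel

/-- For a real parameter the Wronskian of φ with itself is constant, and it vanishes at 0 because
φ(0) = 0. -/
theorem conjTranspose_phi_mul_phiDeriv (hV : IsPotential V) (lam : ℝ) {x : ℝ}
    (hx : x ∈ Icc (0 : ℝ) 1) :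
    (phi V lam x)ᴴ * phiDeriv V lam x = (phiDeriv V lam x)ᴴ * phi V lam x := by
  have hi := hV.intervalIntegrable
  have h := isPrimitive_wronskian hV (solvesODE_phi hi lam) (solvesODE_phi hi lam)
  simp only [sub_self, zero_smul] at h
  have := h.eq_of_primitive_zero hx
  simp only [phi_zero hi, Matrix.conjTranspose_zero, Matrix.zero_mul, Matrix.mul_zero,
    sub_zero] at this
  exact sub_eq_zero.1 this

theorem conjTranspose_S (hV : IntervalIntegrable V volume 0 1) (z : ℂ) {x : ℝ}
    (hx : x ∈ Icc (0 : ℝ) 1) : (S V z x)ᴴ = S V z x := by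
  have h := (isPrimitive_S hV z).conjTranspose
  rw [h.eq_integral x hx, (isPrimitive_S hV z).eq_integral x hx]
  simp only [S_zero, Matrix.conjTranspose_zero, Matrix.conjTranspose_mul,
    Matrix.conjTranspose_conjTranspose]

/-- The quadratic form of a matrix at `v`, as a continuous linear functional of the matrix. -/
def quadCLM (v : Fin N → ℂ) : Matrix (Fin N) (Fin N) ℂ →L[ℝ] ℂ :=
  LinearMap.toContinuousLinearMap
    { toFun := fun M => star v ⬝ᵥ (M *ᵥ v)
      map_add' := fun A B => by rw [Matrix.add_mulVec, dotProduct_add]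
      map_smul' := fun r A => by
        rw [Matrix.smul_mulVec, dotProduct_smul, RingHom.id_apply] }

theorem isPrimitive_quad_S (hV : IntervalIntegrable V volume 0 1) (z : ℂ) (v : Fin N → ℂ) :
    IsPrimitive (fun x => star v ⬝ᵥ (S V z x *ᵥ v))
      (fun x => star v ⬝ᵥ (((phi V z x)ᴴ * phi V z x) *ᵥ v)) :=
  (isPrimitive_S hV z).clm (quadCLM v)

theorem posSemidef_S_sub_S (hV : IntervalIntegrable V volume 0 1) (z : ℂ) {a b : ℝ}
    (ha : a ∈ Icc (0 : ℝ) 1) (hb : b ∈ Icc (0 : ℝ) 1) (hab : a ≤ b) :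
    (S V z b - S V z a).PosSemidef := by
  refine .of_dotProduct_mulVec_nonneg ?_ fun v => ?_
  · rw [Matrix.IsHermitian, Matrix.conjTranspose_sub, conjTranspose_S hV z ha,
      conjTranspose_S hV z hb]
  · rw [Matrix.sub_mulVec, dotProduct_sub, (isPrimitive_quad_S hV z v).sub_eq_integral ha hb]
    have e : ∀ t, star v ⬝ᵥ (((phi V z t)ᴴ * phi V z t) *ᵥ v) =
        (((star v ⬝ᵥ (((phi V z t)ᴴ * phi V z t) *ᵥ v)).re : ℝ) : ℂ) := fun t =>
      Complex.eq_re_of_ofReal_le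
        ((Matrix.posSemidef_conjTranspose_mul_self (phi V z t)).dotProduct_mulVec_nonneg v)
    rw [intervalIntegral.integral_congr fun t _ => e t, intervalIntegral.integral_ofReal]
    refine Complex.zero_le_real.2 (intervalIntegral.integral_nonneg hab fun t _ => ?_)
    exact (Complex.le_def.1 ((Matrix.posSemidef_conjTranspose_mul_self
      (phi V z t)).dotProduct_mulVec_nonneg v)).1

theorem posSemidef_S (hV : IntervalIntegrable V volume 0 1) (z : ℂ) {x : ℝ}
    (hx : x ∈ Icc (0 : ℝ) 1) : (S V z x).PosSemidef := by
  simpa [S_zero] using posSemidef_S_sub_S hV z zero_mem_Icc hx hx.1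

/-- If v*S(1)v = 0, monotonicity forces v*S(x)v = 0 throughout; its derivative is |φ(x)v|², so φ(·)v
= 0 and v = 0. -/
theorem posDef_S_one (hV : IntervalIntegrable V volume 0 1) (z : ℂ) : (S V z 1).PosDef := by
  refine .of_dotProduct_mulVec_pos (posSemidef_S hV z one_mem_Icc).isHermitian fun v hv => ?_
  refine lt_of_le_of_ne ((posSemidef_S hV z one_mem_Icc).dotProduct_mulVec_nonneg v) fun h0 => hv ?_
  have hq := isPrimitive_quad_S hV z v
  have h := (solvesODE_phi hV z).fst
  have hzero : ∀ x ∈ Icc (0 : ℝ) 1, star v ⬝ᵥ (S V z x *ᵥ v) = 0 := fun x hx => by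
    refine le_antisymm ?_ ((posSemidef_S hV z hx).dotProduct_mulVec_nonneg v)
    have := (posSemidef_S_sub_S hV z hx one_mem_Icc hx.2).dotProduct_mulVec_nonneg v
    rw [Matrix.sub_mulVec, dotProduct_sub, ← h0, zero_sub, neg_nonneg] at this
    exact this
  have hcont : ContinuousOn (fun x => star v ⬝ᵥ (((phi V z x)ᴴ * phi V z x) *ᵥ v)) (Icc 0 1) :=
    (quadCLM v).continuous.comp_continuousOn (h.conjTranspose.continuousOn.mul h.continuousOn)
  have hφ : ∀ x ∈ Icc (0 : ℝ) 1, phi V z x *ᵥ v = 0 := fun x hx => by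
    have h1 := hq.hasDerivWithinAt hcont x hx
    have h2 : HasDerivWithinAt (fun x => star v ⬝ᵥ (S V z x *ᵥ v)) 0 (Icc 0 1) x :=
      (hasDerivWithinAt_const x (Icc (0 : ℝ) 1) (0 : ℂ)).congr hzero (hzero x hx)
    have h3 := (uniqueDiffOn_Icc zero_lt_one x hx).eq_deriv _ h1 h2
    rw [← Matrix.mulVec_mulVec, Matrix.dotProduct_mulVec, ← Matrix.star_mulVec] at h3
    exact dotProduct_star_self_eq_zero.1 h3
  have : phiLin V z (WithLp.toLp 2 v) = 0 := funext fun x => hφ x x.2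
  have := phiLin_injective hV z (this.trans (map_zero _).symm)
  exact congrArg WithLp.ofLp this

end Spectral

/-! ### The singularity of the Weyl function at a real point. -/

noncomputable section WeylResidue

open scoped Matrix.Norms.L2Operator

variable {N : ℕ} {V : ℝ → Matrix (Fin N) (Fin N) ℂ}

theorem continuousAt_matrix_inv {M : ℂ → Matrix (Fin N) (Fin N) ℂ} {z : ℂ}
    (hM : ContinuousAt M z) (h : IsUnit (M z)) : ContinuousAt (fun w => (M w)⁻¹) z := by
  simp only [Matrix.nonsing_inv_eq_ringInverse]
  obtain ⟨u, hu⟩ := h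
  have := NormedRing.inverse_continuousAt u
  rw [hu] at this
  exact ContinuousAt.comp (f := M) this hM

theorem continuous_weyl_data (hV : IntervalIntegrable V volume 0 1) :
    (Continuous fun z => (chiPair V z).1 0) ∧ Continuous fun z => (chiPair V z).2 0 := by
  obtain ⟨Y, Y', hY, hY', h⟩ := exists_continuous_chi hV
  refine ⟨?_, ?_⟩
  · simp only [fun z => (h z 0 zero_mem_Icc).1]
    exact hY.comp (continuous_id.prodMk continuous_const)
  · simp only [fun z => (h z 0 zero_mem_Icc).2]
    exact hY'

theorem continuousAt_weyl (hV : IntervalIntegrable V volume 0 1) {z : ℂ}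
    (hz : IsUnit ((chiPair V z).1 0)) : ContinuousAt (weyl V) z :=
  (continuous_weyl_data hV).2.continuousAt.mul
    (continuousAt_matrix_inv (continuous_weyl_data hV).1.continuousAt hz)

theorem continuous_integral_phi_mul_chi (hV : IntervalIntegrable V volume 0 1) (lam : ℂ) :
    Continuous fun z => ∫ t in (0 : ℝ)..1, (phi V lam t)ᴴ * (chiPair V z).1 t := by
  obtain ⟨Y, Y', hY, -, h⟩ := exists_continuous_chi hV
  -- φ is controlled only on [0,1]; it is extended by constants so that the integrand is jointly
  -- continuous.
  let φ : ℝ → Matrix (Fin N) (Fin N) ℂ := fun t => phi V lam (projIcc (0 : ℝ) 1 zero_le_one t)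
  have hφ : Continuous φ := (solvesODE_phi hV lam).fst.continuousOn.comp_continuous
    (continuous_subtype_val.comp continuous_projIcc) fun t => (projIcc (0 : ℝ) 1 zero_le_one t).2
  have e : ∀ z, ∫ t in (0 : ℝ)..1, (phi V lam t)ᴴ * (chiPair V z).1 t =
      ∫ t in (0 : ℝ)..1, (φ t)ᴴ * Y z t := fun z => by
    refine intervalIntegral.integral_congr fun t ht => ?_
    rw [uIcc_of_le (zero_le_one' ℝ)] at ht
    simp only [φ, projIcc_of_mem _ ht, (h z t ht).1]
  simp only [e]
  refine intervalIntegral.continuous_parametric_intervalIntegral_of_continuous' ?_ 0 1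
  exact (hφ.comp continuous_snd).star.mul hY

/-- The Wronskian of φ(·, λ) and χ(·, z) is φ(1)* at 1 and −χ(0) at 0. The identity presents χ(0, z)
as −φ(1, λ)* plus a term carrying the factor z − λ. -/
theorem chi_zero_eq (hV : IsPotential V) (lam : ℝ) (z : ℂ) :
    (chiPair V z).1 0 = -((phi V lam 1)ᴴ +
      (z - lam) • ∫ t in (0 : ℝ)..1, (phi V lam t)ᴴ * (chiPair V z).1 t) := by
  have hi := hV.intervalIntegrable
  obtain ⟨hχ, h1, h1'⟩ := chiPair_spec hi z
  have := (isPrimitive_wronskian hV (solvesODE_phi hi lam) hχ).eq_integral 1 one_mem_Icc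
  rw [h1, h1', phi_zero hi, phiDeriv_zero hi, intervalIntegral.integral_smul,
    ← neg_sub z (lam : ℂ), neg_smul] at this
  simp only [Matrix.mul_one, Matrix.mul_zero, sub_zero, Matrix.conjTranspose_zero,
    Matrix.zero_mul, Matrix.conjTranspose_one, Matrix.one_mul, zero_sub] at this
  rw [this]
  abel

/-- The behaviour of the Weyl function at a real point: at most a simple pole, whose residue is
determined by the orthogonal projection `P` onto `Ker φ(1)` and by `S(1)`. -/
theorem exists_weyl_limit (hV : IsPotential V) (lam : ℝ) :
    ∃ P G B : Matrix (Fin N) (Fin N) ℂ, Pᴴ = P ∧ P * P = P ∧ phi V lam 1 * P = 0 ∧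
      (phi V lam 1)ᴴ * G = 1 - P ∧ Bᴴ = B ∧ P * B = B ∧ B * S V lam 1 * P = P ∧
      (∀ᶠ z in 𝓝[≠] (lam : ℂ), IsUnit ((chiPair V z).1 0)) ∧
      Tendsto (fun z : ℂ => (z - lam) • weyl V z) (𝓝[≠] (lam : ℂ)) (𝓝 (-B)) := by
  have hi := hV.intervalIntegrable
  obtain ⟨P, G, hPH, hPP, hφP, hG⟩ := exists_ker_projection (phi V lam 1)
  obtain ⟨hM0, B, hBM, hBH, hPB, hBSP⟩ :=
    exists_compression_inverse (posDef_S_one hi lam) hPH hPP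
  refine ⟨P, G, B, hPH, hPP, hφP, hG, hBH, hPB, hBSP, ?_⟩
  set J : ℂ → Matrix (Fin N) (Fin N) ℂ :=
    fun z => ∫ t in (0 : ℝ)..1, (phi V lam t)ᴴ * (chiPair V z).1 t with hJ
  have hJc : Continuous J := continuous_integral_phi_mul_chi hi lam
  set D := phiDeriv V lam 1 with hD
  -- on the range of `P`, the solutions `φ` and `χ` are proportional
  have hprop : ∀ x ∈ Icc (0 : ℝ) 1, phi V lam x * P = (chiPair V lam).1 x * (D * P) ∧
      phiDeriv V lam x * P = (chiPair V lam).2 x * (D * P) :=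
    eq_chi_mul hi ((solvesODE_phi hi lam).mul_const P) hφP
  have hJlam : J lam * (D * P) = S V lam 1 * P := by
    rw [S_eq_integral hi lam one_mem_Icc, hJ]
    have h1 := (solvesODE_phi hi lam).fst
    have i1 : IntervalIntegrable (fun t => (phi V lam t)ᴴ * (chiPair V lam).1 t) volume 0 1 :=
      intervalIntegrable_of_continuousOn
        (h1.conjTranspose.continuousOn.mul (chiPair_spec hi lam).1.fst.continuousOn)
    have i2 : IntervalIntegrable (fun t => (phi V lam t)ᴴ * phi V lam t) volume 0 1 :=
      intervalIntegrable_of_continuousOn (h1.conjTranspose.continuousOn.mul h1.continuousOn)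
    have e1 := ((ContinuousLinearMap.mul ℝ (Matrix (Fin N) (Fin N) ℂ)).flip
      (D * P)).intervalIntegral_comp_comm i1
    have e2 := ((ContinuousLinearMap.mul ℝ (Matrix (Fin N) (Fin N) ℂ)).flip
      P).intervalIntegral_comp_comm i2
    simp only [ContinuousLinearMap.flip_apply, ContinuousLinearMap.mul_apply'] at e1 e2
    rw [← e1, ← e2]
    refine intervalIntegral.integral_congr fun t ht => ?_
    rw [uIcc_of_le (zero_le_one' ℝ)] at ht
    simp only [mul_assoc, (hprop t ht).1]
  have hchi' : (chiPair V lam).2 0 * (D * P) = P := by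
    rw [← (hprop 0 zero_mem_Icc).2, phiDeriv_zero hi, one_mul]
  have hTD : (phi V lam 1)ᴴ * (D * P) = 0 := by
    rw [← mul_assoc, hD, conjTranspose_phi_mul_phiDeriv hV lam one_mem_Icc, mul_assoc, hφP,
      mul_zero]
  -- `X` is built so that φ(1)*X = (z − λ)(1 − P). A factor z − λ then splits off from χ(0)X, and
  -- the remaining factor `M` is invertible at λ, where it equals S(1)P + (1 − P).
  set X : ℂ → Matrix (Fin N) (Fin N) ℂ := fun z => D * P + (z - lam) • G with hX
  set M : ℂ → Matrix (Fin N) (Fin N) ℂ := fun z => J z * X z + (1 - P) with hM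
  have hXc : Continuous X :=
    continuous_const.add ((continuous_id.sub continuous_const).smul continuous_const)
  have hMc : Continuous M := (hJc.mul hXc).add continuous_const
  have hXlam : X lam = D * P := by simp [hX]
  have hMlam : M lam = S V lam 1 * P + (1 - P) := by
    change J lam * X lam + (1 - P) = _
    rw [hXlam, hJlam]
  have hchiX : ∀ z, (chiPair V z).1 0 * X z = -((z - lam) • M z) := fun z => by
    rw [chi_zero_eq hV lam z, neg_mul, add_mul]
    change -((phi V lam 1)ᴴ * (D * P + (z - lam) • G) + (z - (lam : ℂ)) • J z * X z) = _
    rw [mul_add, hTD, zero_add, mul_smul_comm, hG, smul_mul_assoc, ← smul_add,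
      add_comm (1 - P)]
  have hMu : IsUnit (M lam) := hMlam ▸ hM0
  have hMe : ∀ᶠ z in 𝓝[≠] (lam : ℂ), IsUnit (M z) :=
    (hMc.continuousAt.eventually_mem (Units.isOpen.mem_nhds hMu)).filter_mono nhdsWithin_le_nhds
  have hne : ∀ᶠ z in 𝓝[≠] (lam : ℂ), z ≠ (lam : ℂ) := eventually_mem_nhdsWithin
  have hchiu : ∀ᶠ z in 𝓝[≠] (lam : ℂ), IsUnit ((chiPair V z).1 0) := by
    filter_upwards [hMe, hne] with z hz hzl
    rw [Matrix.isUnit_iff_isUnit_det] at hz ⊢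
    have h1 := congrArg Matrix.det (hchiX z)
    rw [← smul_neg, Matrix.det_mul, Matrix.det_smul, Matrix.det_neg] at h1
    refine isUnit_of_mul_isUnit_left (y := (X z).det) ?_
    rw [h1, isUnit_iff_ne_zero]
    exact mul_ne_zero (pow_ne_zero _ (sub_ne_zero.2 hzl))
      (mul_ne_zero (pow_ne_zero _ (neg_ne_zero.2 one_ne_zero)) hz.ne_zero)
  refine ⟨hchiu, ?_⟩
  -- Near λ the function (z − λ)m(z) equals −χ'(0)X M⁻¹, which is continuous at λ with value −P
  -- M(λ)⁻¹ = −B.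
  have hlim : Tendsto (fun z : ℂ => -((chiPair V z).2 0 * X z * (M z)⁻¹)) (𝓝[≠] (lam : ℂ))
      (𝓝 (-B)) := by
    have hB : -B = -((chiPair V lam).2 0 * X lam * (M lam)⁻¹) := by
      have h1 := Matrix.mul_nonsing_inv_cancel_right _ B ((Matrix.isUnit_iff_isUnit_det _).1 hM0)
      rw [hBM] at h1
      rw [hXlam, hchi', hMlam, h1]
    rw [hB]
    refine Tendsto.mono_left (ContinuousAt.tendsto ?_) nhdsWithin_le_nhds
    exact (((continuous_weyl_data hi).2.mul hXc).continuousAt.mul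
      (continuousAt_matrix_inv hMc.continuousAt hMu)).neg
  refine hlim.congr' ?_
  filter_upwards [hMe, hchiu] with z hz hc
  rw [Matrix.isUnit_iff_isUnit_det] at hz hc
  have h1 : weyl V z * (-((z - lam) • M z)) = (chiPair V z).2 0 * X z := by
    rw [← hchiX z, weyl, mul_assoc, Matrix.nonsing_inv_mul_cancel_left _ _ hc]
  rw [← h1, mul_neg, neg_mul, neg_neg, mul_smul_comm, smul_mul_assoc,
    Matrix.mul_nonsing_inv_cancel_right _ _ hz]

theorem weylB_eq_of_tendsto (W : ℝ → Matrix (Fin N) (Fin N) ℂ)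
    {m : ℂ → Matrix (Fin N) (Fin N) ℂ} {c : ℂ} {B : Matrix (Fin N) (Fin N) ℂ}
    (hm : ∀ᶠ z in 𝓝[≠] c, weyl W z = m z) (hc : ∀ᶠ z in 𝓝[≠] c, ContinuousAt m z)
    (hlim : Tendsto (fun z => (z - c) • m z) (𝓝[≠] c) (𝓝 (-B))) : weylB W c = B := by
  ext i j
  have h1 : residue (fun z => weyl W z i j) c = -B i j := by
    rw [residue_congr (hm.mono fun z hz => congrFun (congrFun hz i) j :
      (fun z => weyl W z i j) =ᶠ[𝓝[≠] c] fun z => m z i j)]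
    refine residue_eq_of_tendsto (hc.mono fun z hz => ?_) ?_
    · exact ((entryCLM i j).continuous.continuousAt).comp hz
    · exact ((entryCLM i j).continuous.tendsto (-B)).comp hlim
  rw [weylB, Matrix.of_apply, h1, neg_neg]

/-- The residue of the Weyl function at a real point. -/
theorem weylB_spec (hV : IsPotential V) (lam : ℝ) :
    (∃ P G : Matrix (Fin N) (Fin N) ℂ, Pᴴ = P ∧ P * P = P ∧ phi V lam 1 * P = 0 ∧
      (phi V lam 1)ᴴ * G = 1 - P ∧ (weylB V lam)ᴴ = weylB V lam ∧
      P * weylB V lam = weylB V lam ∧ weylB V lam * S V lam 1 * P = P) ∧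
      (∀ᶠ z in 𝓝[≠] (lam : ℂ), IsUnit ((chiPair V z).1 0)) ∧
      Tendsto (fun z : ℂ => (z - lam) • weyl V z) (𝓝[≠] (lam : ℂ)) (𝓝 (-weylB V lam)) := by
  obtain ⟨P, G, B, h1, h2, h3, h4, h5, h6, h7, h8, h9⟩ := exists_weyl_limit hV lam
  have : weylB V lam = B := weylB_eq_of_tendsto V (m := weyl V) (Eventually.of_forall fun _ => rfl)
    (h8.mono fun z hz => continuousAt_weyl hV.intervalIntegrable hz) h9
  rw [this]
  exact ⟨⟨P, G, h1, h2, h3, h4, h5, h6, h7⟩, h8, h9⟩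

end WeylResidue

/-! ### The double commutation transform of potentials and solutions. -/

noncomputable section DoubleCommutation

open scoped Matrix.Norms.L2Operator

variable {N : ℕ}

/-- `(I + A S(x))⁻¹`. -/
def commR (V : ℝ → Matrix (Fin N) (Fin N) ℂ) (z : ℂ) (A : Matrix (Fin N) (Fin N) ℂ) (x : ℝ) :
    Matrix (Fin N) (Fin N) ℂ :=
  (1 + A * S V z x)⁻¹

/-- The transformed solution `φ (I + A S)⁻¹`. -/
def commEta (V : ℝ → Matrix (Fin N) (Fin N) ℂ) (z : ℂ) (A : Matrix (Fin N) (Fin N) ℂ) (x : ℝ) :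
    Matrix (Fin N) (Fin N) ℂ :=
  phi V z x * commR V z A x

/-- `φ (I + A S)⁻¹ A φ*`. -/
def commP (V : ℝ → Matrix (Fin N) (Fin N) ℂ) (z : ℂ) (A : Matrix (Fin N) (Fin N) ℂ) (x : ℝ) :
    Matrix (Fin N) (Fin N) ℂ :=
  commEta V z A x * A * (phi V z x)ᴴ

/-- The derivative of `commEta`. -/
def commEtaDeriv (V : ℝ → Matrix (Fin N) (Fin N) ℂ) (z : ℂ) (A : Matrix (Fin N) (Fin N) ℂ)
    (x : ℝ) : Matrix (Fin N) (Fin N) ℂ :=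
  phiDeriv V z x * commR V z A x - commP V z A x * commEta V z A x

/-- The derivative of `commP`. -/
def commPDeriv (V : ℝ → Matrix (Fin N) (Fin N) ℂ) (z : ℂ) (A : Matrix (Fin N) (Fin N) ℂ) (x : ℝ) :
    Matrix (Fin N) (Fin N) ℂ :=
  commEtaDeriv V z A x * A * (phi V z x)ᴴ + commEta V z A x * A * (phiDeriv V z x)ᴴ

/-- The transformed potential `V - 2 (φ (I + A S)⁻¹ A φ*)'`. -/
def commV (V : ℝ → Matrix (Fin N) (Fin N) ℂ) (z : ℂ) (A : Matrix (Fin N) (Fin N) ℂ) (x : ℝ) :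
    Matrix (Fin N) (Fin N) ℂ :=
  V x - (2 : ℂ) • commPDeriv V z A x

variable {V : ℝ → Matrix (Fin N) (Fin N) ℂ} {lam : ℝ} {A : Matrix (Fin N) (Fin N) ℂ}

theorem isUnit_one_add_mul_S (hV : IntervalIntegrable V volume 0 1) (hA : Aᴴ = A)
    (hU : ∀ x ∈ Icc (0 : ℝ) 1, IsUnit (1 + S V lam x * A).det) {x : ℝ} (hx : x ∈ Icc (0 : ℝ) 1) :
    IsUnit (1 + A * S V lam x).det := by
  have e : (1 + A * S V lam x) = (1 + S V lam x * A)ᴴ := by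
    rw [Matrix.conjTranspose_add, Matrix.conjTranspose_mul, hA, conjTranspose_S hV _ hx,
      Matrix.conjTranspose_one]
  rw [e, Matrix.det_conjTranspose]
  exact (hU x hx).star

/-- Push-through identity, from A(1 + SA) = (1 + AS)A. It identifies `commP` with φKφ* and makes K
Hermitian. -/
theorem commR_mul_eq (hV : IntervalIntegrable V volume 0 1) (hA : Aᴴ = A)
    (hU : ∀ x ∈ Icc (0 : ℝ) 1, IsUnit (1 + S V lam x * A).det) {x : ℝ} (hx : x ∈ Icc (0 : ℝ) 1) :
    commR V lam A x * A = A * (1 + S V lam x * A)⁻¹ := by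
  have h1 := isUnit_one_add_mul_S hV hA hU hx
  have e : A * (1 + S V lam x * A) = (1 + A * S V lam x) * A := by
    rw [mul_add, add_mul, mul_one, one_mul, mul_assoc]
  calc commR V lam A x * A
      = commR V lam A x * (A * (1 + S V lam x * A)) * (1 + S V lam x * A)⁻¹ := by
        rw [mul_assoc, Matrix.mul_nonsing_inv_cancel_right _ _ (hU x hx)]
    _ = A * (1 + S V lam x * A)⁻¹ := by
        rw [e, commR, Matrix.nonsing_inv_mul_cancel_left _ _ h1]

theorem conjTranspose_commR_mul (hV : IntervalIntegrable V volume 0 1) (hA : Aᴴ = A)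
    (hU : ∀ x ∈ Icc (0 : ℝ) 1, IsUnit (1 + S V lam x * A).det) {x : ℝ} (hx : x ∈ Icc (0 : ℝ) 1) :
    (commR V lam A x * A)ᴴ = commR V lam A x * A := by
  rw [commR_mul_eq hV hA hU hx, Matrix.conjTranspose_mul, Matrix.conjTranspose_nonsing_inv,
    Matrix.conjTranspose_add, Matrix.conjTranspose_mul, hA, conjTranspose_S hV _ hx,
    Matrix.conjTranspose_one, ← commR_mul_eq hV hA hU hx, commR]

theorem isPrimitive_commR (hV : IntervalIntegrable V volume 0 1) (hA : Aᴴ = A)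
    (hU : ∀ x ∈ Icc (0 : ℝ) 1, IsUnit (1 + S V lam x * A).det) :
    IsPrimitive (commR V lam A) fun x =>
      -(commR V lam A x * A * ((phi V lam x)ᴴ * phi V lam x) * commR V lam A x) := by
  have hφ := (solvesODE_phi hV (lam : ℂ)).fst
  have hφφ : ContinuousOn (fun x => (phi V lam x)ᴴ * phi V lam x) (Icc 0 1) :=
    hφ.conjTranspose.continuousOn.mul hφ.continuousOn
  have hS := (isPrimitive_S hV (lam : ℂ)).const_mul A
  have hd : ∀ x ∈ Icc (0 : ℝ) 1, HasDerivWithinAt (commR V lam A)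
      (-(commR V lam A x * A * ((phi V lam x)ᴴ * phi V lam x) * commR V lam A x)) (Icc 0 1) x := by
    intro x hx
    obtain ⟨u, hu⟩ := (Matrix.isUnit_iff_isUnit_det _).2 (isUnit_one_add_mul_S hV hA hU hx)
    have h1 : HasDerivWithinAt (fun x => 1 + A * S V lam x)
        (A * ((phi V lam x)ᴴ * phi V lam x)) (Icc 0 1) x :=
      (hS.hasDerivWithinAt (continuousOn_const.mul hφφ) x hx).const_add 1
    have h2 := hasFDerivAt_ringInverse (𝕜 := ℝ) u
    rw [hu] at h2
    have h3 := h2.comp_hasDerivWithinAt x h1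
    have hR : commR V lam A x =
        ((u⁻¹ : (Matrix (Fin N) (Fin N) ℂ)ˣ) : Matrix (Fin N) (Fin N) ℂ) := by
      rw [commR, ← hu, Matrix.coe_units_inv]
    have e : commR V lam A = fun x => Ring.inverse (1 + A * S V lam x) := by
      funext t
      rw [commR, Matrix.nonsing_inv_eq_ringInverse]
    rw [hR, e]
    refine h3.congr_deriv ?_
    simp only [neg_apply, ContinuousLinearMap.mulLeftRight_apply, mul_assoc]
  have hRc : ContinuousOn (commR V lam A) (Icc 0 1) := fun x hx => (hd x hx).continuousWithinAt
  exact .of_hasDerivWithinAt hd (((hRc.mul continuousOn_const).mul hφφ).mul hRc).neg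

theorem isPrimitive_commEta (hV : IntervalIntegrable V volume 0 1) (hA : Aᴴ = A)
    (hU : ∀ x ∈ Icc (0 : ℝ) 1, IsUnit (1 + S V lam x * A).det) :
    IsPrimitive (commEta V lam A) (commEtaDeriv V lam A) := by
  refine ((solvesODE_phi hV (lam : ℂ)).fst.mul (isPrimitive_commR hV hA hU)).congr
    (fun x _ => rfl) (ae_of_all _ fun x => ?_)
  simp only [commEtaDeriv, commP, commEta, mul_assoc, mul_neg, sub_eq_add_neg]

theorem isPrimitive_commP (hV : IntervalIntegrable V volume 0 1) (hA : Aᴴ = A)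
    (hU : ∀ x ∈ Icc (0 : ℝ) 1, IsUnit (1 + S V lam x * A).det) :
    IsPrimitive (commP V lam A) (commPDeriv V lam A) :=
  ((isPrimitive_commEta hV hA hU).mul_const A).mul (solvesODE_phi hV (lam : ℂ)).fst.conjTranspose

/-- The transformed function at the distinguished spectral parameter. -/
theorem solvesODE_commEta (hV : IsPotential V) (hA : Aᴴ = A)
    (hU : ∀ x ∈ Icc (0 : ℝ) 1, IsUnit (1 + S V lam x * A).det) :
    SolvesODE (fun t => commV V lam A t - (lam : ℂ) • (1 : Matrix (Fin N) (Fin N) ℂ))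
      (commEta V lam A) (commEtaDeriv V lam A) := by
  have hi := hV.intervalIntegrable
  refine ⟨isPrimitive_commEta hi hA hU, ?_⟩
  refine (((solvesODE_phi hi (lam : ℂ)).snd.mul (isPrimitive_commR hi hA hU)).sub
    ((isPrimitive_commP hi hA hU).mul (isPrimitive_commEta hi hA hU))).congr
    (fun x _ => rfl) (ae_Ioo_of_forall_Icc fun x hx => ?_)
  have hw := conjTranspose_phi_mul_phiDeriv hV lam hx
  have e : commPDeriv V lam A x * commEta V lam A x =
      phiDeriv V lam x * (commR V lam A x * A * ((phi V lam x)ᴴ * phi V lam x) * commR V lam A x) +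
        commP V lam A x * commEtaDeriv V lam A x := by
    -- The symmetry φ*φ' = φ'*φ moves the derivative onto φ*.
    have h1 : commP V lam A x * (phiDeriv V lam x * commR V lam A x) =
        commEta V lam A x * A * (phiDeriv V lam x)ᴴ * commEta V lam A x := by
      rw [commP, commEta, mul_assoc _ ((phi V lam x)ᴴ), ← mul_assoc ((phi V lam x)ᴴ), hw]
      simp only [mul_assoc]
    rw [commPDeriv, commEtaDeriv, mul_sub, h1, add_mul, sub_mul, sub_mul, sub_mul]
    simp only [commP, commEta, mul_assoc]
    abel
  simp only [commV, sub_mul, two_smul, add_mul, e, Matrix.smul_mul, Matrix.one_mul]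
  simp only [commEta, mul_assoc, mul_neg]
  abel

/-- The transformed solutions at the other spectral parameters. -/
theorem solvesODE_transform (hV : IsPotential V) (hA : Aᴴ = A)
    (hU : ∀ x ∈ Icc (0 : ℝ) 1, IsUnit (1 + S V lam x * A).det) {z : ℂ} (hz : z ≠ lam)
    {y y' : ℝ → Matrix (Fin N) (Fin N) ℂ}
    (hy : SolvesODE (fun t => V t - z • (1 : Matrix (Fin N) (Fin N) ℂ)) y y') :
    SolvesODE (fun t => commV V lam A t - z • (1 : Matrix (Fin N) (Fin N) ℂ))
      (fun x => y x + (commEta V lam A x * A) *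
        ((z - lam)⁻¹ • ((phi V lam x)ᴴ * y' x - (phiDeriv V lam x)ᴴ * y x)))
      (fun x => y' x + (commEtaDeriv V lam A x * A) *
        ((z - lam)⁻¹ • ((phi V lam x)ᴴ * y' x - (phiDeriv V lam x)ᴴ * y x)) -
        commP V lam A x * y x) := by
  have hi := hV.intervalIntegrable
  have hη := solvesODE_commEta hV hA hU
  have hzl : z - lam ≠ 0 := sub_ne_zero.2 hz
  -- After division by z − λ the Wronskian has derivative −φ*y, free of the spectral parameter.
  have hw : IsPrimitive
      (fun x => (z - lam)⁻¹ • ((phi V lam x)ᴴ * y' x - (phiDeriv V lam x)ᴴ * y x))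
      (fun x => -((phi V lam x)ᴴ * y x)) := by
    refine ((isPrimitive_wronskian hV (solvesODE_phi hi lam) hy).clm
      (((z - lam)⁻¹ • ContinuousLinearMap.id ℂ (Matrix (Fin N) (Fin N) ℂ)).restrictScalars
        ℝ)).congr (fun x _ => rfl) (ae_of_all _ fun x => ?_)
    change (z - (lam : ℂ))⁻¹ • (((lam : ℂ) - z) • ((phi V lam x)ᴴ * y x)) = _
    rw [smul_smul, ← neg_sub z, mul_neg, inv_mul_cancel₀ hzl, neg_one_smul]
  constructor
  · refine (hy.fst.add ((hη.fst.mul_const A).mul hw)).congr (fun x _ => rfl)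
      (ae_of_all _ fun x => ?_)
    simp only [commP, mul_neg, mul_assoc]
    abel
  · refine ((hy.snd.add ((hη.snd.mul_const A).mul hw)).sub
      ((isPrimitive_commP hi hA hU).mul hy.fst)).congr (fun x _ => rfl)
      (ae_of_all _ fun x => ?_)
    set w := (z - lam)⁻¹ • ((phi V lam x)ᴴ * y' x - (phiDeriv V lam x)ᴴ * y x) with hwdef
    -- Solving the definition of w for φ*y' trades the term λw, produced by η'', for the term zw
    -- that the equation at z demands.
    have hw' : (phi V lam x)ᴴ * y' x = z • w - (lam : ℂ) • w + (phiDeriv V lam x)ᴴ * y x := by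
      rw [← sub_smul, hwdef, smul_smul, mul_inv_cancel₀ hzl, one_smul, sub_add_cancel]
    have e : commP V lam A x * y' x = commEta V lam A x * A * (z • w - (lam : ℂ) • w) +
        commEta V lam A x * A * ((phiDeriv V lam x)ᴴ * y x) := by
      rw [commP, mul_assoc, hw', mul_add]
    simp only [e, commV, commPDeriv, two_smul]
    simp only [mul_add, add_mul, mul_sub, sub_mul, mul_neg, Matrix.smul_mul, Matrix.mul_smul,
      Matrix.one_mul, mul_assoc]
    abel

end DoubleCommutation

/-! ### Kernels, orthogonal complements and dimensions. -/

noncomputable section Subspaces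

variable {N : ℕ}

theorem toEuclideanLin_ofLp (M : Matrix (Fin N) (Fin N) ℂ) (c : EuclideanSpace ℂ (Fin N)) :
    (Matrix.toEuclideanLin M c).ofLp = M *ᵥ c.ofLp := rfl

theorem toEuclideanLin_mul_apply (M M' : Matrix (Fin N) (Fin N) ℂ)
    (c : EuclideanSpace ℂ (Fin N)) :
    Matrix.toEuclideanLin M (Matrix.toEuclideanLin M' c) = Matrix.toEuclideanLin (M * M') c := by
  apply WithLp.ofLp_injective
  simp only [toEuclideanLin_ofLp, Matrix.mulVec_mulVec]

theorem inner_toEuclideanLin (M : Matrix (Fin N) (Fin N) ℂ) (c d : EuclideanSpace ℂ (Fin N)) :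
    inner ℂ c (Matrix.toEuclideanLin M d) = inner ℂ (Matrix.toEuclideanLin Mᴴ c) d := by
  rw [EuclideanSpace.inner_eq_star_dotProduct, EuclideanSpace.inner_eq_star_dotProduct,
    toEuclideanLin_ofLp, toEuclideanLin_ofLp, Matrix.star_mulVec,
    Matrix.conjTranspose_conjTranspose, dotProduct_comm, Matrix.dotProduct_mulVec, dotProduct_comm]

theorem ker_toEuclideanLin_eq_bot {M : Matrix (Fin N) (Fin N) ℂ} (hM : IsUnit M.det) :
    LinearMap.ker (Matrix.toEuclideanLin M) = ⊥ := by
  rw [LinearMap.ker_eq_bot']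
  intro c hc
  have := congrArg (Matrix.toEuclideanLin M⁻¹) hc
  rw [toEuclideanLin_mul_apply, Matrix.nonsing_inv_mul _ hM, map_zero] at this
  rw [← this]
  apply WithLp.ofLp_injective
  rw [toEuclideanLin_ofLp, Matrix.one_mulVec]

theorem finrank_coKer (B : Matrix (Fin N) (Fin N) ℂ) : Module.finrank ℂ (coKer B) = B.rank := by
  have h1 := Submodule.finrank_add_finrank_orthogonal (LinearMap.ker (Matrix.toEuclideanLin B))
  have h2 := (Matrix.toEuclideanLin B).finrank_range_add_finrank_ker
  have h3 : B.rank = Module.finrank ℂ (LinearMap.range (Matrix.toEuclideanLin B)) :=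
    B.rank_eq_finrank_range_toLin (PiLp.basisFun 2 ℂ (Fin N)) (PiLp.basisFun 2 ℂ (Fin N))
  rw [coKer, h3]
  omega

theorem toEuclideanLin_mem_coKer {B : Matrix (Fin N) (Fin N) ℂ} (hB : Bᴴ = B)
    (c : EuclideanSpace ℂ (Fin N)) : Matrix.toEuclideanLin B c ∈ coKer B := by
  rw [coKer, Submodule.mem_orthogonal]
  intro k hk
  rw [inner_toEuclideanLin, hB, LinearMap.mem_ker.1 hk, inner_zero_left]

/-- The complement of Ker B and (SE)^⊥ have complementary dimensions, so meeting trivially means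
spanning everything; orthogonal complements turn this sum into Ker B ∩ SE = 0. -/
theorem ker_inf_map_eq_bot {B S : Matrix (Fin N) (Fin N) ℂ} (hS : IsUnit S.det)
    {E : Submodule ℂ (EuclideanSpace ℂ (Fin N))} (hrank : B.rank = Module.finrank ℂ E)
    (h : coKer B ⊓ (E.map (Matrix.toEuclideanLin S))ᗮ = ⊥) :
    LinearMap.ker (Matrix.toEuclideanLin B) ⊓ E.map (Matrix.toEuclideanLin S) = ⊥ := by
  set L := E.map (Matrix.toEuclideanLin S)
  have hL : Module.finrank ℂ L = Module.finrank ℂ E :=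
    (Submodule.equivMapOfInjective _
      (LinearMap.ker_eq_bot.1 (ker_toEuclideanLin_eq_bot hS)) E).finrank_eq.symm
  have h1 := Submodule.finrank_add_finrank_orthogonal L
  have h2 := finrank_coKer B
  have htop : coKer B ⊔ Lᗮ = ⊤ := by
    refine Submodule.eq_top_of_disjoint _ _ ?_ (disjoint_iff.2 h)
    omega
  have h3 := Submodule.inf_orthogonal (coKer B) Lᗮ
  rw [htop, Submodule.top_orthogonal_eq_bot, coKer, Submodule.orthogonal_orthogonal,
    Submodule.orthogonal_orthogonal] at h3
  exact h3

end Subspaces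

/-! ### Spectral data of the transformed potential. -/

noncomputable section Transformed

open scoped Matrix.Norms.L2Operator

variable {N : ℕ} {V : ℝ → Matrix (Fin N) (Fin N) ℂ} {lam : ℝ} {A : Matrix (Fin N) (Fin N) ℂ}

/-- A form that shows the symmetry: RA is Hermitian where I + SA is invertible, so conjugate
transposition swaps the outer terms and fixes the middle one. -/
theorem commPDeriv_eq (x : ℝ) :
    commPDeriv V lam A x = phiDeriv V lam x * (commR V lam A x * A) * (phi V lam x)ᴴ -
      commP V lam A x * commP V lam A x +
      phi V lam x * (commR V lam A x * A) * (phiDeriv V lam x)ᴴ := by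
  simp only [commPDeriv, commEtaDeriv, commP, commEta, sub_mul, mul_assoc]

theorem isHermitian_commP (hV : IntervalIntegrable V volume 0 1) (hA : Aᴴ = A)
    (hU : ∀ x ∈ Icc (0 : ℝ) 1, IsUnit (1 + S V lam x * A).det) {x : ℝ} (hx : x ∈ Icc (0 : ℝ) 1) :
    (commP V lam A x)ᴴ = commP V lam A x := by
  have e : commP V lam A x = phi V lam x * (commR V lam A x * A) * (phi V lam x)ᴴ := by
    simp only [commP, commEta, mul_assoc]
  rw [e, Matrix.conjTranspose_mul, Matrix.conjTranspose_mul, conjTranspose_commR_mul hV hA hU hx,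
    Matrix.conjTranspose_conjTranspose, ← mul_assoc (phi V lam x)]

theorem isHermitian_commPDeriv (hV : IntervalIntegrable V volume 0 1) (hA : Aᴴ = A)
    (hU : ∀ x ∈ Icc (0 : ℝ) 1, IsUnit (1 + S V lam x * A).det) {x : ℝ} (hx : x ∈ Icc (0 : ℝ) 1) :
    (commPDeriv V lam A x)ᴴ = commPDeriv V lam A x := by
  have h : ∀ M M' : Matrix (Fin N) (Fin N) ℂ, (M * (commR V lam A x * A) * M'ᴴ)ᴴ =
      M' * (commR V lam A x * A) * Mᴴ := fun M M' => by
    rw [Matrix.conjTranspose_mul, Matrix.conjTranspose_mul, conjTranspose_commR_mul hV hA hU hx,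
      Matrix.conjTranspose_conjTranspose, ← mul_assoc M']
  rw [commPDeriv_eq, Matrix.conjTranspose_add, Matrix.conjTranspose_sub, h, h,
    Matrix.conjTranspose_mul, isHermitian_commP hV hA hU hx]
  abel

/-- 𝒫' is made of η, η', φ and φ' only, each absolutely continuous. This is why Ṽ − V is more
regular than V. -/
theorem exists_isPrimitive_commPDeriv (hV : IsPotential V) (hA : Aᴴ = A)
    (hU : ∀ x ∈ Icc (0 : ℝ) 1, IsUnit (1 + S V lam x * A).det) :
    ∃ W, IsPrimitive (commPDeriv V lam A) W := by
  have hφ := solvesODE_phi hV.intervalIntegrable (lam : ℂ)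
  have hη := solvesODE_commEta hV hA hU
  exact ⟨_, ((hη.snd.mul_const A).mul hφ.fst.conjTranspose).add
    ((hη.fst.mul_const A).mul hφ.snd.conjTranspose)⟩

theorem isPotential_commV (hV : IsPotential V) (hA : Aᴴ = A)
    (hU : ∀ x ∈ Icc (0 : ℝ) 1, IsUnit (1 + S V lam x * A).det) :
    IsPotential (commV V lam A) := by
  obtain ⟨W, hW⟩ := exists_isPrimitive_commPDeriv hV hA hU
  refine ⟨?_, fun i j => ?_⟩
  · filter_upwards [hV.hermitian, ae_restrict_mem measurableSet_Ioo] with x hx hxI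
    rw [Matrix.IsHermitian, commV, Matrix.conjTranspose_sub, hx.eq, Matrix.conjTranspose_smul,
      isHermitian_commPDeriv hV.intervalIntegrable hA hU ⟨hxI.1.le, hxI.2.le⟩]
    simp
  · rw [← intervalIntegrable_iff_integrableOn_Ioo_of_le zero_le_one]
    have h1 : IntervalIntegrable (fun x => V x i j) volume 0 1 := by
      rw [intervalIntegrable_iff_integrableOn_Ioo_of_le zero_le_one]
      exact hV.integrable i j
    have h2 : IntervalIntegrable (fun x => (2 : ℂ) * commPDeriv V lam A x i j) volume 0 1 :=
      (intervalIntegrable_of_continuousOn (hW.entry i j).continuousOn).const_mul 2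
    exact h1.sub h2

theorem commR_zero : commR V lam A 0 = 1 := by simp [commR, S_zero]

theorem commEta_zero (hV : IntervalIntegrable V volume 0 1) : commEta V lam A 0 = 0 := by
  rw [commEta, phi_zero hV, zero_mul]

theorem commP_zero (hV : IntervalIntegrable V volume 0 1) : commP V lam A 0 = 0 := by
  rw [commP, commEta_zero hV, zero_mul, zero_mul]

theorem commEtaDeriv_zero (hV : IntervalIntegrable V volume 0 1) :
    commEtaDeriv V lam A 0 = 1 := by
  rw [commEtaDeriv, phiDeriv_zero hV, commR_zero, commP_zero hV, zero_mul, sub_zero, mul_one]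

theorem phi_commV (hV : IsPotential V) (hA : Aᴴ = A)
    (hU : ∀ x ∈ Icc (0 : ℝ) 1, IsUnit (1 + S V lam x * A).det) {x : ℝ} (hx : x ∈ Icc (0 : ℝ) 1) :
    phi (commV V lam A) lam x = commEta V lam A x := by
  have hi := hV.intervalIntegrable
  have := (eq_phi_mul (isPotential_commV hV hA hU).intervalIntegrable
    (solvesODE_commEta hV hA hU) (commEta_zero hi) x hx).1
  rw [commEtaDeriv_zero hi, mul_one] at this
  exact this.symm

/-- Both sides, taken as functions of the end point, vanish at 0 and have the same derivative: (SR)'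
= (1 − SRA)φ*φR, where 1 − SRA = R*, and this is η*η. -/
theorem S_commV_one (hV : IsPotential V) (hA : Aᴴ = A)
    (hU : ∀ x ∈ Icc (0 : ℝ) 1, IsUnit (1 + S V lam x * A).det) :
    S (commV V lam A) lam 1 = S V lam 1 * commR V lam A 1 := by
  have hi := hV.intervalIntegrable
  have h1 := (isPrimitive_S hi (lam : ℂ)).mul (isPrimitive_commR hi hA hU)
  have h2 := (isPrimitive_S (isPotential_commV hV hA hU).intervalIntegrable (lam : ℂ)).sub h1
  have h3 := h2.congr (f' := _) (g' := fun _ => 0) (fun _ _ => rfl)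
    (ae_Ioo_of_forall_Icc fun x hx => ?_)
  · have := h3.eq_of_primitive_zero one_mem_Icc
    rw [S_zero, S_zero, zero_mul, sub_zero] at this
    exact sub_eq_zero.1 this
  · have hR : (commR V lam A x)ᴴ = 1 - S V lam x * (commR V lam A x * A) := by
      have e1 : (1 + S V lam x * A) * (1 - S V lam x * (commR V lam A x * A)) = 1 := by
        have e2 : (1 + A * S V lam x) * commR V lam A x = 1 :=
          Matrix.mul_nonsing_inv _ (isUnit_one_add_mul_S hi hA hU hx)
        have e3 : (1 + S V lam x * A) * (S V lam x * (commR V lam A x * A)) =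
            S V lam x * ((1 + A * S V lam x) * commR V lam A x) * A := by
          simp only [add_mul, mul_add, one_mul, mul_assoc]
        rw [mul_sub, mul_one, e3, e2, mul_one, add_sub_cancel_right]
      have e5 : (commR V lam A x)ᴴ = (1 + S V lam x * A)⁻¹ := by
        rw [commR, Matrix.conjTranspose_nonsing_inv, Matrix.conjTranspose_add,
          Matrix.conjTranspose_mul, hA, conjTranspose_S hi _ hx, Matrix.conjTranspose_one]
      rw [e5, Matrix.inv_eq_right_inv e1]
    rw [phi_commV hV hA hU hx, commEta, Matrix.conjTranspose_mul, hR]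
    simp only [sub_mul, mul_neg, one_mul, mul_assoc]
    abel

/-- w vanishes at 0, so the transform of φ(·, z) has the right initial data; at 1 the term with
φ(1)*φ'(1, z) drops out because 𝒫(1) = 0. -/
theorem phi_commV_of_ne (hV : IsPotential V) (hA : Aᴴ = A)
    (hU : ∀ x ∈ Icc (0 : ℝ) 1, IsUnit (1 + S V lam x * A).det) {z : ℂ} (hz : z ≠ lam)
    (hP1 : commP V lam A 1 = 0) :
    phi (commV V lam A) z 1 =
      (1 - (z - lam)⁻¹ • (commEta V lam A 1 * A * (phiDeriv V lam 1)ᴴ)) * phi V z 1 := by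
  have hi := hV.intervalIntegrable
  have h := (eq_phi_mul (isPotential_commV hV hA hU).intervalIntegrable
    (solvesODE_transform hV hA hU hz (solvesODE_phi hi z))
    (by simp [phi_zero hi]) 1 one_mem_Icc).1
  simp only [phi_zero hi, phiDeriv_zero hi, Matrix.conjTranspose_zero, mul_zero,
    sub_zero, smul_zero, add_zero, mul_one] at h
  rw [← h, Matrix.mul_smul, mul_sub, ← mul_assoc (commEta V lam A 1 * A)]
  have : commEta V lam A 1 * A * (phi V lam 1)ᴴ = 0 := hP1
  rw [this, zero_mul, zero_sub, smul_neg, sub_mul, one_mul, Matrix.smul_mul,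
    mul_assoc _ _ (phi V z 1), ← sub_eq_add_neg]

/-- The factor 1 − Q is invertible since Q² = 0: the product contains φ'(1)*φ(1) = φ(1)*φ'(1), which
exposes 𝒫(1) = 0. -/
theorem E_commV_of_ne (hV : IsPotential V) (hA : Aᴴ = A)
    (hU : ∀ x ∈ Icc (0 : ℝ) 1, IsUnit (1 + S V lam x * A).det) {z : ℂ} (hz : z ≠ lam)
    (hP1 : commP V lam A 1 = 0) : E (commV V lam A) z = E V z := by
  set Q := (z - lam)⁻¹ • (commEta V lam A 1 * A * (phiDeriv V lam 1)ᴴ) with hQ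
  have hQQ : Q * Q = 0 := by
    have : commEta V lam A 1 * A * (phiDeriv V lam 1)ᴴ *
        (commEta V lam A 1 * A * (phiDeriv V lam 1)ᴴ) = 0 := by
      calc _ = commEta V lam A 1 * A * ((phiDeriv V lam 1)ᴴ * phi V lam 1) *
            (commR V lam A 1 * A * (phiDeriv V lam 1)ᴴ) := by
            simp only [commEta, mul_assoc]
        _ = commP V lam A 1 * phiDeriv V lam 1 * (commR V lam A 1 * A * (phiDeriv V lam 1)ᴴ) := by
            rw [← conjTranspose_phi_mul_phiDeriv hV lam one_mem_Icc]
            simp only [commP, mul_assoc]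
        _ = 0 := by rw [hP1, zero_mul, zero_mul]
    rw [hQ, Matrix.smul_mul, Matrix.mul_smul, this, smul_zero, smul_zero]
  have hinv : (1 + Q) * (1 - Q) = 1 := by
    rw [mul_sub, add_mul, add_mul, hQQ, one_mul, one_mul, mul_one]
    abel
  ext c
  rw [mem_E, mem_E, phi_commV_of_ne hV hA hU hz hP1, ← hQ, ← Matrix.mulVec_mulVec]
  refine ⟨fun h => ?_, fun h => by rw [h, Matrix.mulVec_zero]⟩
  have := congrArg ((1 + Q) *ᵥ ·) h
  simpa only [Matrix.mulVec_mulVec, ← mul_assoc, hinv, one_mul, Matrix.mulVec_zero] using this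

/-- As 𝒫(1) = 0, the transform of χ vanishes at 1, so it is χ̃ times a constant matrix. At 0 it has
value χ(0) and derivative χ'(0) − (z − λ)⁻¹Aχ(0), and the constant matrix cancels in the quotient.
-/
theorem weyl_commV (hV : IsPotential V) (hA : Aᴴ = A)
    (hU : ∀ x ∈ Icc (0 : ℝ) 1, IsUnit (1 + S V lam x * A).det) {z : ℂ} (hz : z ≠ lam)
    (hP1 : commP V lam A 1 = 0) (hχ : IsUnit ((chiPair V z).1 0)) :
    weyl (commV V lam A) z = weyl V z - (z - lam)⁻¹ • A := by
  have hi := hV.intervalIntegrable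
  obtain ⟨hs, h1, h1'⟩ := chiPair_spec hi z
  have hP1' : commEta V lam A 1 * A * (phi V lam 1)ᴴ = 0 := hP1
  obtain ⟨e, e'⟩ := eq_chi_mul (isPotential_commV hV hA hU).intervalIntegrable
    (solvesODE_transform hV hA hU hz hs)
    (by simp only [h1, h1', mul_one, mul_zero, sub_zero, zero_add, Matrix.mul_smul, hP1',
      smul_zero]) 0 zero_mem_Icc
  simp only [commEta_zero hi, commEtaDeriv_zero hi, commP_zero hi, phi_zero hi, phiDeriv_zero hi,
    zero_mul, add_zero, neg_zero, sub_zero, Matrix.conjTranspose_zero, Matrix.conjTranspose_one,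
    one_mul, zero_sub, smul_neg, mul_neg, Matrix.mul_smul] at e e'
  rw [Matrix.isUnit_iff_isUnit_det] at hχ
  have hu : IsUnit ((chiPair (commV V lam A) z).1 0).det := by
    rw [e, Matrix.det_mul] at hχ
    exact isUnit_of_mul_isUnit_left hχ
  have key : weyl (commV V lam A) z * (chiPair V z).1 0 =
      (chiPair V z).2 0 + -((z - lam)⁻¹ • (A * (chiPair V z).1 0)) := by
    rw [e', e, weyl, mul_assoc, Matrix.nonsing_inv_mul_cancel_left _ _ hu]
  rw [← Matrix.mul_nonsing_inv_cancel_right _ (weyl (commV V lam A) z) hχ, key, weyl, add_mul,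
    neg_mul, Matrix.smul_mul, Matrix.mul_nonsing_inv_cancel_right _ _ hχ, ← sub_eq_add_neg]

theorem tendsto_smul_sub_smul_inv {m : ℂ → Matrix (Fin N) (Fin N) ℂ} {c l : ℂ}
    {B : Matrix (Fin N) (Fin N) ℂ} (h : Tendsto (fun z => (z - c) • m z) (𝓝[≠] c) (𝓝 (-B)))
    (hc : c ≠ l) :
    Tendsto (fun z => (z - c) • (m z - (z - l)⁻¹ • A)) (𝓝[≠] c) (𝓝 (-B)) := by
  have h1 : Tendsto (fun z : ℂ => ((z - c) * (z - l)⁻¹) • A) (𝓝[≠] c) (𝓝 0) := by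
    have : ContinuousAt (fun z : ℂ => ((z - c) * (z - l)⁻¹) • A) c :=
      ((continuousAt_id.sub continuousAt_const).mul ((continuousAt_id.sub
        continuousAt_const).inv₀ (sub_ne_zero.2 hc))).smul continuousAt_const
    have := this.tendsto
    simp only [sub_self, zero_mul, zero_smul] at this
    exact this.mono_left nhdsWithin_le_nhds
  have h2 := h.sub h1
  rw [sub_zero] at h2
  refine h2.congr fun z => ?_
  rw [smul_sub, smul_smul]

theorem continuousAt_sub_smul_inv {m : ℂ → Matrix (Fin N) (Fin N) ℂ} {z l : ℂ}
    (h : ContinuousAt m z) (hz : z ≠ l) : ContinuousAt (fun w => m w - (w - l)⁻¹ • A) z :=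
  h.sub (((continuousAt_id.sub continuousAt_const).inv₀ (sub_ne_zero.2 hz)).smul
    continuousAt_const)

/-- The correction (z − λ)⁻¹A is continuous at `mu`, hence adds nothing to the residue. -/
theorem weylB_commV_of_ne (hV : IsPotential V) (hA : Aᴴ = A)
    (hU : ∀ x ∈ Icc (0 : ℝ) 1, IsUnit (1 + S V lam x * A).det) (hP1 : commP V lam A 1 = 0)
    {mu : ℝ} (hmu : mu ≠ lam) : weylB (commV V lam A) mu = weylB V mu := by
  obtain ⟨-, hu, hlim⟩ := weylB_spec hV mu
  have hne : ∀ᶠ z in 𝓝[≠] (mu : ℂ), z ≠ (lam : ℂ) :=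
    (eventually_ne_nhds (by exact_mod_cast hmu)).filter_mono nhdsWithin_le_nhds
  refine weylB_eq_of_tendsto _ (m := fun z => weyl V z - (z - lam)⁻¹ • A) ?_ ?_
    (tendsto_smul_sub_smul_inv hlim (by exact_mod_cast hmu))
  · filter_upwards [hu, hne] with z h1 h2 using weyl_commV hV hA hU h2 hP1 h1
  · filter_upwards [hu, hne] with z h1 h2 using
      continuousAt_sub_smul_inv (continuousAt_weyl hV.intervalIntegrable h1) h2

theorem weylB_commV (hV : IsPotential V) (hA : Aᴴ = A)
    (hU : ∀ x ∈ Icc (0 : ℝ) 1, IsUnit (1 + S V lam x * A).det) (hP1 : commP V lam A 1 = 0) :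
    weylB (commV V lam A) lam = weylB V lam + A := by
  obtain ⟨-, hu, hlim⟩ := weylB_spec hV lam
  have hne : ∀ᶠ z in 𝓝[≠] (lam : ℂ), z ≠ (lam : ℂ) := eventually_mem_nhdsWithin
  refine weylB_eq_of_tendsto _ (m := fun z => weyl V z - (z - lam)⁻¹ • A) ?_ ?_ ?_
  · filter_upwards [hu, hne] with z h1 h2 using weyl_commV hV hA hU h2 hP1 h1
  · filter_upwards [hu, hne] with z h1 h2 using
      continuousAt_sub_smul_inv (continuousAt_weyl hV.intervalIntegrable h1) h2
  · have h2 := hlim.sub_const A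
    rw [neg_add, ← sub_eq_add_neg]
    refine h2.congr' ?_
    filter_upwards [hne] with z hz
    rw [smul_sub, smul_smul, mul_inv_cancel₀ (sub_ne_zero.2 hz), one_smul]

end Transformed

/-! ### Admissible residues and conclusion. -/

noncomputable section Final

open scoped Matrix.Norms.L2Operator

variable {N : ℕ} {V W : ℝ → Matrix (Fin N) (Fin N) ℂ} {lam : ℝ} {A : Matrix (Fin N) (Fin N) ℂ}

/-- `tildeV` is identified with `commV` on [0,1] only, while φ and χ are selected by
`Classical.epsilon`. Equality almost everywhere makes the selecting predicates equivalent, so the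
selected functions are literally equal. -/
theorem isMatrixSolution_congr (h : ∀ᵐ x ∂volume.restrict (Ioo (0 : ℝ) 1), V x = W x) (z : ℂ)
    (Y Y' : ℝ → Matrix (Fin N) (Fin N) ℂ) :
    IsMatrixSolution V z Y Y' ↔ IsMatrixSolution W z Y Y' := by
  rw [isMatrixSolution_iff, isMatrixSolution_iff]
  exact ⟨fun hY => hY.congr_ae (h.mono fun x hx => by rw [hx]),
    fun hY => hY.congr_ae (h.mono fun x hx => by rw [hx])⟩

theorem phiPair_congr (h : ∀ᵐ x ∂volume.restrict (Ioo (0 : ℝ) 1), V x = W x) :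
    phiPair V = phiPair W := by
  funext z
  simp only [phiPair, isMatrixSolution_congr h]

theorem chiPair_congr (h : ∀ᵐ x ∂volume.restrict (Ioo (0 : ℝ) 1), V x = W x) :
    chiPair V = chiPair W := by
  funext z
  simp only [chiPair, isMatrixSolution_congr h]

theorem E_congr (h : ∀ᵐ x ∂volume.restrict (Ioo (0 : ℝ) 1), V x = W x) : E V = E W := by
  funext z
  simp only [E, phi, phiPair_congr h]

theorem F_congr (h : ∀ᵐ x ∂volume.restrict (Ioo (0 : ℝ) 1), V x = W x) : F V = F W := by
  funext z
  simp only [F, E_congr h, S, phi, phiPair_congr h]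

theorem weylB_congr (h : ∀ᵐ x ∂volume.restrict (Ioo (0 : ℝ) 1), V x = W x) :
    weylB V = weylB W := by
  funext z
  simp only [weylB, weyl, chiPair_congr h]

theorem E_commV (hV : IsPotential V) (hA : Aᴴ = A)
    (hU : ∀ x ∈ Icc (0 : ℝ) 1, IsUnit (1 + S V lam x * A).det) :
    E (commV V lam A) lam =
      (E V lam).map (Matrix.toEuclideanLin (1 + A * S V lam 1)) := by
  have hM := isUnit_one_add_mul_S hV.intervalIntegrable hA hU one_mem_Icc
  have hRM : commR V lam A 1 * (1 + A * S V lam 1) = 1 := Matrix.nonsing_inv_mul _ hM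
  have hMR : (1 + A * S V lam 1) * commR V lam A 1 = 1 := Matrix.mul_nonsing_inv _ hM
  ext c
  rw [mem_E, phi_commV hV hA hU one_mem_Icc, commEta, ← Matrix.mulVec_mulVec]
  constructor
  · intro h
    refine ⟨Matrix.toEuclideanLin (commR V lam A 1) c, mem_E.2 h, ?_⟩
    rw [toEuclideanLin_mul_apply, hMR]
    exact WithLp.ofLp_injective _ (Matrix.one_mulVec _)
  · rintro ⟨e, he, rfl⟩
    rw [toEuclideanLin_ofLp, Matrix.mulVec_mulVec, Matrix.mulVec_mulVec, mul_assoc, hRM, mul_one]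
    exact mem_E.1 he

/-- The factors cancel: S̃(1)Ẽ = S(1)R(1)·R(1)⁻¹E = S(1)E. -/
theorem F_commV (hV : IsPotential V) (hA : Aᴴ = A)
    (hU : ∀ x ∈ Icc (0 : ℝ) 1, IsUnit (1 + S V lam x * A).det) :
    F (commV V lam A) lam = F V lam := by
  have hM := isUnit_one_add_mul_S hV.intervalIntegrable hA hU one_mem_Icc
  have hRM : commR V lam A 1 * (1 + A * S V lam 1) = 1 := Matrix.nonsing_inv_mul _ hM
  rw [F, F, E_commV hV hA hU, S_commV_one hV hA hU, ← Submodule.map_comp]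
  congr 2
  ext1 c
  rw [LinearMap.comp_apply, toEuclideanLin_mul_apply, mul_assoc, hRM, mul_one]

theorem isIsospectral_of_E (hV : IsPotential V) (hW : IsPotential W)
    (h : ∀ z, Module.finrank ℂ (E W z) = Module.finrank ℂ (E V z)) : IsIsospectral V W where
  isPotential := hW
  eigenvalue_iff z := by
    rw [isEigenvalue_iff hW.intervalIntegrable, isEigenvalue_iff hV.intervalIntegrable, h]
  multiplicity_eq z := by
    rw [multiplicity_eq_finrank hW.intervalIntegrable, multiplicity_eq_finrank
      hV.intervalIntegrable, h]

/-- `G` certifies that P reaches all of Ker φ(1): a vector killed by φ(1) is killed by Gᴴφ(1) = 1 −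
P. -/
theorem mem_E_iff_of_projection {P G : Matrix (Fin N) (Fin N) ℂ} {z : ℂ} (hP : Pᴴ = P)
    (hφP : phi V z 1 * P = 0) (hG : (phi V z 1)ᴴ * G = 1 - P) (c : EuclideanSpace ℂ (Fin N)) :
    c ∈ E V z ↔ P *ᵥ c.ofLp = c.ofLp := by
  rw [mem_E]
  constructor
  · intro h
    have e : Gᴴ * phi V z 1 = 1 - P := by
      have := congrArg Matrix.conjTranspose hG
      rwa [Matrix.conjTranspose_mul, Matrix.conjTranspose_conjTranspose,
        Matrix.conjTranspose_sub, Matrix.conjTranspose_one, hP] at this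
    have h1 := congrArg (Gᴴ *ᵥ ·) h
    simp only [Matrix.mulVec_mulVec, e, Matrix.mulVec_zero, Matrix.sub_mulVec,
      Matrix.one_mulVec] at h1
    exact (sub_eq_zero.1 h1).symm
  · intro h
    rw [← h, Matrix.mulVec_mulVec, hφP, Matrix.zero_mulVec]

/-- The admissible residues `B` give invertible `I + S(x) A` for `A = B - B_α`, and the range of
`φ_α(1)*` is annihilated by `φ_α(1) K(1)`. -/
theorem admissible_spec (hV : IsPotential V) {B : Matrix (Fin N) (Fin N) ℂ} (hB : B.PosSemidef)
    (hrank : B.rank = Module.finrank ℂ (E V lam)) (hF : coKer B ⊓ F V lam = ⊥) :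
    (B - weylB V lam)ᴴ = B - weylB V lam ∧
      (∀ x ∈ Icc (0 : ℝ) 1, IsUnit (1 + S V lam x * (B - weylB V lam)).det) ∧
      commP V lam (B - weylB V lam) 1 = 0 ∧
      (E V lam).map (Matrix.toEuclideanLin (1 + (B - weylB V lam) * S V lam 1)) ≤ coKer B := by
  have hi := hV.intervalIntegrable
  obtain ⟨⟨P, G, hP, hPP, hφP, hG, hbH, hPb, hbSP⟩, -⟩ := weylB_spec hV lam
  set b := weylB V lam
  set T := S V lam 1 with hT
  have hE := mem_E_iff_of_projection hP hφP hG
  have hTH : Tᴴ = T := conjTranspose_S hi _ one_mem_Icc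
  have hTu : IsUnit T.det := (Matrix.isUnit_iff_isUnit_det _).1 (posDef_S_one hi lam).isUnit
  have hbP : b * P = b := by
    have := congrArg Matrix.conjTranspose hPb
    rwa [Matrix.conjTranspose_mul, hbH, hP] at this
  have hbTb : b * T * b = b := by
    calc b * T * b = b * T * P * b := by rw [mul_assoc _ P, hPb]
      _ = b := by rw [hbSP, hPb]
  have hPTb : P * T * b = P := by
    have := congrArg Matrix.conjTranspose hbSP
    rwa [Matrix.conjTranspose_mul, Matrix.conjTranspose_mul, hbH, hP, hTH, ← mul_assoc] at this
  have hA : (B - b)ᴴ = B - b := by rw [Matrix.conjTranspose_sub, hB.isHermitian.eq, hbH]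
  have hbot := ker_inf_map_eq_bot hTu hrank hF
  have hU : ∀ x ∈ Icc (0 : ℝ) 1, IsUnit (1 + S V lam x * (B - b)).det := fun x hx => by
    refine isUnit_det_one_add_mul hB hbH (posSemidef_S hi _ hx)
      (posSemidef_S_sub_S hi _ hx one_mem_Icc hx.2) hbTb fun c hc => ?_
    -- The range of b lies in E because Pb = b, so Tbc lies in TE as well as in Ker B.
    have hmem : WithLp.toLp 2 (T *ᵥ (b *ᵥ c)) ∈
        LinearMap.ker (Matrix.toEuclideanLin B) ⊓ (E V lam).map (Matrix.toEuclideanLin T) := by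
      refine ⟨LinearMap.mem_ker.2 (congrArg (WithLp.toLp 2) hc), WithLp.toLp 2 (b *ᵥ c), ?_, rfl⟩
      rw [SetLike.mem_coe, hE, Matrix.mulVec_mulVec, hPb]
    rw [hbot, Submodule.mem_bot] at hmem
    have h0 : T *ᵥ (b *ᵥ c) = 0 := congrArg WithLp.ofLp hmem
    have := congrArg (T⁻¹ *ᵥ ·) h0
    simpa only [Matrix.mulVec_mulVec, ← mul_assoc, Matrix.nonsing_inv_mul _ hTu, one_mul,
      Matrix.mulVec_zero] using this
  refine ⟨hA, hU, ?_, ?_⟩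
  -- PTBc = 0 says that Bc is orthogonal to TE, that is, Bc lies in F; it also lies in the
  -- complement of Ker B.
  · have hBC : ∀ c : Fin N → ℂ, P *ᵥ (T *ᵥ (B *ᵥ c)) = 0 → B *ᵥ c = 0 := fun c hc => by
      have hmem : Matrix.toEuclideanLin B (WithLp.toLp 2 c) ∈ coKer B ⊓ F V lam := by
        refine ⟨toEuclideanLin_mem_coKer hB.isHermitian.eq _, ?_⟩
        rw [SetLike.mem_coe, F, Submodule.mem_orthogonal]
        rintro _ ⟨e, he, rfl⟩
        have hPe : Matrix.toEuclideanLin P e = e := WithLp.ofLp_injective _ ((hE e).1 he)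
        have h0 : Matrix.toEuclideanLin P (Matrix.toEuclideanLin T
            (Matrix.toEuclideanLin B (WithLp.toLp 2 c))) = 0 := congrArg (WithLp.toLp 2) hc
        have h1 := inner_toEuclideanLin T e (Matrix.toEuclideanLin B (WithLp.toLp 2 c))
        rw [hTH] at h1
        rw [← hT, ← h1, ← hPe]
        have h2 := inner_toEuclideanLin P e
          (Matrix.toEuclideanLin T (Matrix.toEuclideanLin B (WithLp.toLp 2 c)))
        rw [hP] at h2
        rw [← h2, h0, inner_zero_right]
      rw [hF, Submodule.mem_bot] at hmem
      exact congrArg WithLp.ofLp hmem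
    -- 𝒫(1) = φ(1)(B − b)C, so it suffices that BC = 0: the rest, bC = PbC, is killed by φ(1).
    set C := (1 + T * (B - b))⁻¹ * (phi V lam 1)ᴴ with hC
    have hCeq : C + T * (B - b) * C = (phi V lam 1)ᴴ := by
      have := Matrix.mul_nonsing_inv_cancel_left _ (phi V lam 1)ᴴ (hU 1 one_mem_Icc)
      rwa [← hT, ← hC, add_mul, one_mul] at this
    have hbφ : b * (phi V lam 1)ᴴ = 0 := by
      have h1 : P * (phi V lam 1)ᴴ = 0 := by
        have := congrArg Matrix.conjTranspose hφP
        rwa [Matrix.conjTranspose_mul, hP, Matrix.conjTranspose_zero] at this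
      rw [← hbP, mul_assoc, h1, mul_zero]
    -- Multiply `hCeq` by b on the left: bφ(1)* = 0, and bTb = b cancels the two bC terms.
    have h1 : b * T * B * C = 0 := by
      have := congrArg (b * ·) hCeq
      simp only [hbφ] at this
      have e : b * (C + T * (B - b) * C) = b * C + b * T * B * C - b * T * b * C := by
        simp only [mul_add, mul_sub, sub_mul, mul_assoc]
        abel
      rw [← this, e, hbTb, add_sub_cancel_left]
    have h2 : P * T * B * C = 0 := by
      calc P * T * B * C = P * T * (b * T * B * C) := by
            rw [← hPTb]
            simp only [mul_assoc]
            rw [← mul_assoc b T (b * _), ← mul_assoc (b * T) b, hbTb]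
        _ = 0 := by rw [h1, mul_zero]
    have h3 : B * C = 0 := by
      ext i j
      have h4 : P *ᵥ (T *ᵥ (B *ᵥ (C *ᵥ Pi.single j 1))) = 0 := by
        simp only [Matrix.mulVec_mulVec, ← mul_assoc, h2, Matrix.zero_mulVec]
      have h5 := congrFun (hBC _ h4) i
      rw [Matrix.mulVec_mulVec, Matrix.mulVec_single_one] at h5
      exact h5
    have h4 : commP V lam (B - b) 1 = phi V lam 1 * ((B - b) * C) := by
      rw [commP, commEta, mul_assoc (phi V lam 1), commR_mul_eq hi hA hU one_mem_Icc, hC]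
      simp only [mul_assoc]
      rfl
    rw [h4, sub_mul, h3, zero_sub, ← hPb, mul_neg, mul_assoc, ← mul_assoc, hφP, zero_mul, neg_zero]
  · rintro _ ⟨e, he, rfl⟩
    have hPe : P *ᵥ e.ofLp = e.ofLp := (hE e).1 he
    -- On E one has bTe = e, which cancels the identity and leaves BTe.
    have : Matrix.toEuclideanLin (1 + (B - b) * T) e =
        Matrix.toEuclideanLin B (Matrix.toEuclideanLin T e) := by
      apply WithLp.ofLp_injective
      simp only [toEuclideanLin_ofLp, Matrix.mulVec_mulVec]
      have h1 : (b * T) *ᵥ e.ofLp = e.ofLp := by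
        rw [← hPe, Matrix.mulVec_mulVec, hbSP]
      rw [sub_mul, Matrix.add_mulVec, Matrix.sub_mulVec, Matrix.one_mulVec, h1]
      abel
    rw [this]
    exact toEuclideanLin_mem_coKer hB.isHermitian.eq _

theorem phiKphi_eq (hV : IsPotential V) {B : Matrix (Fin N) (Fin N) ℂ}
    (hA : (B - weylB V lam)ᴴ = B - weylB V lam)
    (hU : ∀ x ∈ Icc (0 : ℝ) 1, IsUnit (1 + S V lam x * (B - weylB V lam)).det) {x : ℝ}
    (hx : x ∈ Icc (0 : ℝ) 1) : phiKphi V lam B x = commP V lam (B - weylB V lam) x := by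
  rw [phiKphi, K, ← commR_mul_eq hV.intervalIntegrable hA hU hx, commP, commEta,
    mul_assoc (phi V lam x) (commR V lam _ x)]

theorem hasDerivWithinAt_phiKphi (hV : IsPotential V) {B : Matrix (Fin N) (Fin N) ℂ}
    (hA : (B - weylB V lam)ᴴ = B - weylB V lam)
    (hU : ∀ x ∈ Icc (0 : ℝ) 1, IsUnit (1 + S V lam x * (B - weylB V lam)).det) {x : ℝ}
    (hx : x ∈ Icc (0 : ℝ) 1) (i j : Fin N) :
    HasDerivWithinAt (fun t => phiKphi V lam B t i j)
      (commPDeriv V lam (B - weylB V lam) x i j) (Icc 0 1) x := by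
  obtain ⟨W, hW⟩ := exists_isPrimitive_commPDeriv hV hA hU
  have h := ((isPrimitive_commP hV.intervalIntegrable hA hU).entry i j).hasDerivWithinAt
    (hW.entry i j).continuousOn x hx
  exact h.congr (fun t ht => by rw [phiKphi_eq hV hA hU ht]) (by rw [phiKphi_eq hV hA hU hx])

theorem tildeV_eq (hV : IsPotential V) {B : Matrix (Fin N) (Fin N) ℂ}
    (hA : (B - weylB V lam)ᴴ = B - weylB V lam)
    (hU : ∀ x ∈ Icc (0 : ℝ) 1, IsUnit (1 + S V lam x * (B - weylB V lam)).det) {x : ℝ}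
    (hx : x ∈ Icc (0 : ℝ) 1) : tildeV V lam B x = commV V lam (B - weylB V lam) x := by
  rw [tildeV, commV]
  congr 2
  ext i j
  exact (hasDerivWithinAt_phiKphi hV hA hU hx i j).derivWithin
    (uniqueDiffOn_Icc zero_lt_one x hx)

theorem IsPotential.congr (hV : IsPotential V)
    (h : ∀ᵐ x ∂volume.restrict (Ioo (0 : ℝ) 1), V x = W x) : IsPotential W where
  hermitian := by
    filter_upwards [hV.hermitian, h] with x h1 h2
    rwa [← h2]
  integrable i j := (hV.integrable i j).congr (h.mono fun x hx => by
    change V x i j = W x i j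
    rw [hx])

theorem double_commutation (hV : IsPotential V) {B : Matrix (Fin N) (Fin N) ℂ}
    (hB : B.PosSemidef) (hrank : B.rank = multiplicity V lam) (hF : coKer B ⊓ F V lam = ⊥) :
    (∀ x ∈ Set.Icc (0 : ℝ) 1, IsUnit (1 + S V lam x * (B - weylB V lam)).det) ∧
    (∀ x ∈ Set.Icc (0 : ℝ) 1, (K V lam B x).IsHermitian) ∧
    (∀ i j, DifferentiableOn ℝ (fun x => phiKphi V lam B x i j) (Set.Icc (0 : ℝ) 1)) ∧
    HasIntegrableDeriv (fun x => tildeV V lam B x - V x) ∧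
    IsIsospectral V (tildeV V lam B) ∧
    (∀ mu : ℝ, mu ≠ lam → weylB (tildeV V lam B) mu = weylB V mu) ∧
    weylB (tildeV V lam B) lam = B ∧
    E (tildeV V lam B) lam = coKer B ∧
    F (tildeV V lam B) lam = F V lam := by
  have hi := hV.intervalIntegrable
  rw [multiplicity_eq_finrank hi] at hrank
  obtain ⟨hA, hU, hP1, hle⟩ := admissible_spec hV hB hrank hF
  have hcomm : ∀ᵐ x ∂volume.restrict (Ioo (0 : ℝ) 1),
      commV V lam (B - weylB V lam) x = tildeV V lam B x :=
    ae_Ioo_of_forall_Icc fun x hx => (tildeV_eq hV hA hU hx).symm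
  have hE := E_commV hV hA hU
  have hfin : Module.finrank ℂ (E (commV V lam (B - weylB V lam)) lam) =
      Module.finrank ℂ (E V lam) := by
    rw [hE]
    exact (Submodule.equivMapOfInjective _ (LinearMap.ker_eq_bot.1 (ker_toEuclideanLin_eq_bot
      (isUnit_one_add_mul_S hi hA hU one_mem_Icc))) (E V lam)).finrank_eq.symm
  rw [← F_congr hcomm, ← E_congr hcomm, ← weylB_congr hcomm]
  refine ⟨hU, fun x hx => ?_, fun i j x hx =>
    (hasDerivWithinAt_phiKphi hV hA hU hx i j).differentiableWithinAt, ?_, ?_,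
    fun mu hmu => weylB_commV_of_ne hV hA hU hP1 hmu, ?_, ?_, F_commV hV hA hU⟩
  · rw [Matrix.IsHermitian, K, ← commR_mul_eq hi hA hU hx, conjTranspose_commR_mul hi hA hU hx]
  · obtain ⟨W, hW⟩ := exists_isPrimitive_commPDeriv hV hA hU
    have hsub : ∀ x ∈ Icc (0 : ℝ) 1, -((2 : ℝ) • commPDeriv V lam (B - weylB V lam) x) =
        tildeV V lam B x - V x := fun x hx => by
      rw [tildeV_eq hV hA hU hx, commV, sub_sub_cancel_left, two_smul, two_smul]
    have h2 := ((hW.clm ((2 : ℝ) • ContinuousLinearMap.id ℝ _)).neg).congr hsub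
      (ae_of_all _ fun _ => rfl)
    refine ⟨_, fun i j => ?_, fun x hx i j => (h2.entry i j).eq_integral x hx⟩
    rw [← intervalIntegrable_iff_integrableOn_Ioo_of_le zero_le_one]
    exact (h2.entry i j).integrable
  · refine isIsospectral_of_E hV ((isPotential_commV hV hA hU).congr hcomm) fun z => ?_
    rw [← E_congr hcomm]
    by_cases hz : z = lam
    · rw [hz, hfin]
    · rw [E_commV_of_ne hV hA hU hz hP1]
  · rw [weylB_commV hV hA hU hP1, add_sub_cancel]
  -- The inclusion is an equality since both sides have dimension rank B = dim E.
  · refine Submodule.eq_of_le_of_finrank_eq (hE ▸ hle) ?_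
    rw [hfin, finrank_coKer, hrank]

end Final

end SturmLiouville

open SturmLiouville in
theorem theorem3p4 {N : ℕ} (V : ℝ → Matrix (Fin N) (Fin N) ℂ) (hV : IsPotential V)
    (lam : ℝ) (hlam : IsEigenvalue V lam)
    (B : Matrix (Fin N) (Fin N) ℂ) (hB : B.PosSemidef)
    (hrank : B.rank = multiplicity V lam)
    (hF : coKer B ⊓ F V lam = ⊥) :
    -- the formulas for `K` and for the new potential make sense, with self-adjoint values
    (∀ x ∈ Set.Icc (0 : ℝ) 1, IsUnit (1 + S V lam x * (B - weylB V lam)).det) ∧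
    (∀ x ∈ Set.Icc (0 : ℝ) 1, (K V lam B x).IsHermitian) ∧
    (∀ i j, DifferentiableOn ℝ (fun x => phiKphi V lam B x i j) (Set.Icc (0 : ℝ) 1)) ∧
    HasIntegrableDeriv (fun x => tildeV V lam B x - V x) ∧
    IsIsospectral V (tildeV V lam B) ∧
    (∀ mu : ℝ, IsEigenvalue V mu → mu ≠ lam → weylB (tildeV V lam B) mu = weylB V mu) ∧
    weylB (tildeV V lam B) lam = B ∧
    E (tildeV V lam B) lam = coKer B ∧
    F (tildeV V lam B) lam = F V lam := by
  obtain ⟨h1, h2, h3, h4, h5, h6, h7⟩ := double_commutation hV hB hrank hF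
  exact ⟨h1, h2, h3, h4, h5, fun mu _ hmu => h6 mu hmu, h7⟩
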